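/- Let $\mathbb{D}=\{z\in\mathbb{C}:|z|<1\}$, let $m$ be Lebesgue area measure on $\mathbb{D}$ normalized so that $m(\mathbb{D})=1$, and put $\varphi_a(z)=(a-z)/(1-\overline{a}z)$ for $a,z\in\mathbb{D}$. A finite or infinite sequence $\{z_n\}$ in $\mathbb{D}$ is called separated if there is a constant $\delta>0$ such that $|z_n-z_k|/|1-\overline{z}_nz_k|>\delta$ for all $n\neq k$, and uniformly separated if there is a constant $\delta>0$ such that $\prod_{n\neq k}\left|\frac{z_n-z_k}{1-\overline{z}_nz_k}\right|\geq\delta$ for every $k$. Let $A_0,A_1,A_2$ be analytic in $\mathbb{D}$, and let $f$ be a non-trivial (that is, not identically zero) analytic solution in $\mathbb{D}$ of $$f'''+A_2f''+A_1f'+A_0f=0.$$ (i) If $\sup_{z\in\mathbb{D}}|A_j(z)|(1-|z|^2)^{3-j}<\infty$ for $j=0,1,2$, then the sequence of two-fold zeros of $f$ in $\mathbb{D}$ (zeros of multiplicity exactly two, each listed once) is a finite union of separated sequences. (ii) If $\sup_{a\in\mathbb{D}}\int_{\mathbb{D}}|A_j(z)|(1-|z|^2)^{1-j}\bigl(1-|\varphi_a(z)|^2\bigr)\,dm(z)<\infty$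 for $j=0,1,2$, then the sequence of two-fold zeros of $f$ in $\mathbb{D}$ is a finite union of uniformly separated sequences. -/

import Mathlib

noncomputable section

namespace DiskODE

/-- The open unit disc of the complex plane. -/
def disk : Set ℂ := Metric.ball 0 1

/-- Lebesgue area measure on the unit disc, normalized so that the disc has mass one. -/
def areaMeasure : MeasureTheory.Measure ℂ :=
  (MeasureTheory.volume disk)⁻¹ • MeasureTheory.volume.restrict disk

/-- The disc automorphism `φ_a(z) = (a - z) / (1 - conj a * z)`, which is its own inverse. -/
def diskAut (a z : ℂ) : ℂ := (a - z) / (1 - (starRingEnd ℂ) a * z)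

/-- The pseudo-hyperbolic distance `|z - w| / |1 - conj z * w|`. -/
def pseudoDist (z w : ℂ) : ℝ := ‖z - w‖ / ‖1 - (starRingEnd ℂ) z * w‖

/-- `f` is analytic in the unit disc and solves `f''' + A₂ f'' + A₁ f' + A₀ f = 0` there. -/
def IsSolution (A : Fin 3 → ℂ → ℂ) (f : ℂ → ℂ) : Prop :=
  DifferentiableOn ℂ f disk ∧
    ∀ z ∈ disk, iteratedDeriv 3 f z + A 2 z * iteratedDeriv 2 f z + A 1 z * deriv f z
      + A 0 z * f z = 0

/-- The zeros of `f` in the unit disc whose multiplicity is exactly two. -/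
def twoFoldZeros (f : ℂ → ℂ) : Set ℂ := {z | z ∈ disk ∧ analyticOrderAt f z = 2}

/-- A (finite or infinite) sequence in the disc that is separated in the hyperbolic metric. The
points of such a sequence are pairwise distinct, so it is given by the set of its points. -/
def IsSeparated (S : Set ℂ) : Prop :=
  S ⊆ disk ∧ ∃ δ : ℝ, 0 < δ ∧ ∀ z ∈ S, ∀ w ∈ S, z ≠ w → δ < pseudoDist z w

/-- A (finite or infinite) uniformly separated sequence in the disc, given by the set of its
points, which are necessarily distinct. The factors lie in `[0, 1]`, so that the unordered
infinite product always exists. -/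
def IsUniformlySeparated (S : Set ℂ) : Prop :=
  S ⊆ disk ∧ ∃ δ : ℝ, 0 < δ ∧ ∀ z ∈ S, δ ≤ ∏' w : {w : ℂ // w ∈ S ∧ w ≠ z}, pseudoDist w z

/-- `Z` is the union of finitely many sets that have the property `P`. -/
def IsFiniteUnionOf (P : Set ℂ → Prop) (Z : Set ℂ) : Prop :=
  ∃ (n : ℕ) (S : Fin n → Set ℂ), (∀ i, P (S i)) ∧ Z = ⋃ i, S i

end DiskODE

end

/-!
Both parts hold with a single set: under (i) the two-fold zeros themselves form a separated
sequence, under (ii) a uniformly separated one.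

(i) If `a ≠ b` are two-fold zeros, restrict `f` to the segment from `a` to `b`. Since `f'` vanishes
at both ends, `f''` has mean zero along the segment, so `f''`, `f'` and `f`, scaled by the powers of
the length, are all bounded by the maximum of the scaled `f'''`. When `b` is close to `a` the
equation bounds `f'''` by a small multiple of these (`eq_zero_of_boundary_zeros`), which forces
`f'' a = 0`, against the multiplicity being exactly two (`eq_of_mem_twoFoldZeros_of_small`).

(ii) Fix a two-fold zero `a`. The function `g = (f ∘ φ_a) / φ_a'` satisfies
`g''' = (φ_a') ^ 2 * (f''' ∘ φ_a)` (Bol's lemma), hence a third order equation whose coefficients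
are controlled by the `density` built from the functions `(A j ∘ φ_a) * (φ_a') ^ (3 - j)`
(`exists_transported_solution`). After normalization `g 0 = g' 0 = 0` and `g'' 0 = 2`, and a
Gronwall argument along radii bounds `log |g|` on a circle by the radial integral of the density
(`norm_circle_le_exp`). The integral of the density over the disc is, up to the normalization of
area, the sum of the three quantities in the Carleson conditions, by the change of variables
`w = φ_a z` (`lintegral_pullbackCoeff`); near the origin, where `ds dθ` is not dominated by
`s ds dθ`, the density is bounded by the mean value property (`density_le_of_norm_le_half`). So the
circle means of `log |g / z ^ 2|` are bounded uniformly in `a` and in the radius, and Jensen's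
formula for `g / z ^ 2`, which takes the value `1` at the origin, bounds `∏ |φ_a w|` over the zeros
`w ≠ a` of `f` from below (`exp_neg_le_prod_pseudoDist`).
-/

namespace DiskODE

open Set Filter Topology MeasureTheory
open scoped ComplexConjugate Real

/-! ### The derivatives of `f` at a two-fold zero -/

lemma iteratedDeriv_analyticOnNhd {f : ℂ → ℂ} (hf : DifferentiableOn ℂ f disk) (n : ℕ) :
    AnalyticOnNhd ℂ (iteratedDeriv n f) disk := by
  rw [iteratedDeriv_eq_iterate]
  exact (hf.analyticOnNhd Metric.isOpen_ball).iterated_deriv n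

lemma hasDerivAt_iteratedDeriv {f : ℂ → ℂ} (hf : DifferentiableOn ℂ f disk) (n : ℕ) {z : ℂ}
    (hz : z ∈ disk) : HasDerivAt (iteratedDeriv n f) (iteratedDeriv (n + 1) f z) z := by
  rw [iteratedDeriv_succ]
  exact (iteratedDeriv_analyticOnNhd hf n z hz).differentiableAt.hasDerivAt

lemma derivatives_of_mem_twoFoldZeros {f : ℂ → ℂ} (hf : DifferentiableOn ℂ f disk) {a : ℂ}
    (ha : a ∈ twoFoldZeros f) :
    f a = 0 ∧ iteratedDeriv 1 f a = 0 ∧ iteratedDeriv 2 f a ≠ 0 := by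
  obtain ⟨hd, ho⟩ := ha
  have h0 := iteratedDeriv_analyticOnNhd hf 0 a hd
  rw [iteratedDeriv_zero] at h0
  have hh := (natCast_le_analyticOrderAt_iff_iteratedDeriv_eq_zero h0 (n := 2)).1 (by rw [ho]; rfl)
  have h3 : ¬ ∀ i < 3, iteratedDeriv i f a = 0 := by
    rw [← natCast_le_analyticOrderAt_iff_iteratedDeriv_eq_zero h0 (n := 3), ho]
    decide
  refine ⟨by simpa using hh 0 (by norm_num), hh 1 (by norm_num), fun h2 => h3 fun i hi => ?_⟩
  interval_cases i
  exacts [hh 0 (by norm_num), hh 1 (by norm_num), h2]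

/-! ### Two nearby double zeros on a segment -/

/-- On the unit interval a function of mean zero is bounded by a bound for its derivative. -/
lemma norm_le_of_integral_eq_zero {g g' : ℝ → ℂ} {S : ℝ}
    (hg : ∀ t ∈ Icc (0 : ℝ) 1, HasDerivAt g (g' t) t) (hS : ∀ t ∈ Icc (0 : ℝ) 1, ‖g' t‖ ≤ S)
    (hint : ∫ t in (0 : ℝ)..1, g t = 0) {t : ℝ} (ht : t ∈ Icc (0 : ℝ) 1) : ‖g t‖ ≤ S := by
  have hc : ContinuousOn g (uIcc 0 1) := by
    rw [uIcc_of_le zero_le_one]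
    exact fun s hs => (hg s hs).continuousAt.continuousWithinAt
  have h1 : g t = ∫ s in (0 : ℝ)..1, (g t - g s) := by
    rw [intervalIntegral.integral_sub (by simp) hc.intervalIntegrable, hint]
    simp
  rw [h1]
  have h2 : ∀ s ∈ uIoc (0 : ℝ) 1, ‖g t - g s‖ ≤ S := by
    intro s hs
    rw [uIoc_of_le zero_le_one] at hs
    have hs' : s ∈ Icc (0 : ℝ) 1 := ⟨hs.1.le, hs.2⟩
    have := (convex_Icc (0 : ℝ) 1).norm_image_sub_le_of_norm_hasDerivWithin_le
      (fun x hx => (hg x hx).hasDerivWithinAt) hS hs' ht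
    refine this.trans ?_
    have hS0 : 0 ≤ S := (norm_nonneg _).trans (hS t ht)
    have : ‖t - s‖ ≤ 1 := by
      rw [Real.norm_eq_abs, abs_le]
      constructor <;> linarith [ht.1, ht.2, hs'.1, hs'.2]
    nlinarith
  simpa using intervalIntegral.norm_integral_le_of_norm_le_const h2

lemma norm_le_of_hasDerivAt_of_eq_zero {g g' : ℝ → ℂ} {S : ℝ}
    (hg : ∀ t ∈ Icc (0 : ℝ) 1, HasDerivAt g (g' t) t) (hS : ∀ t ∈ Icc (0 : ℝ) 1, ‖g' t‖ ≤ S)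
    (h0 : g 0 = 0) {t : ℝ} (ht : t ∈ Icc (0 : ℝ) 1) : ‖g t‖ ≤ S := by
  have := (convex_Icc (0 : ℝ) 1).norm_image_sub_le_of_norm_hasDerivWithin_le
    (fun x hx => (hg x hx).hasDerivWithinAt) hS (left_mem_Icc.2 zero_le_one) ht
  rw [h0, sub_zero, sub_zero, Real.norm_eq_abs, abs_of_nonneg ht.1] at this
  have hS0 : 0 ≤ S := (norm_nonneg _).trans (hS t ht)
  nlinarith [ht.2]

/-- A function with `g₀ = g₁ = 0` at `0` and `g₁ = 0` at `1`, where each `gₖ₊₁` is the derivative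
of `gₖ`, has all of `g₀, g₁, g₂` bounded by `max ‖g₃‖`. If `‖g₃‖` is in turn at most a multiple
`κ < 1` of such a common bound, it vanishes identically, and so does `g₂`. -/
lemma eq_zero_of_boundary_zeros {g₀ g₁ g₂ g₃ : ℝ → ℂ} {κ : ℝ} (hκ : κ < 1)
    (h₀ : ∀ t ∈ Icc (0 : ℝ) 1, HasDerivAt g₀ (g₁ t) t)
    (h₁ : ∀ t ∈ Icc (0 : ℝ) 1, HasDerivAt g₁ (g₂ t) t)
    (h₂ : ∀ t ∈ Icc (0 : ℝ) 1, HasDerivAt g₂ (g₃ t) t)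
    (h₃ : ContinuousOn g₃ (Icc 0 1))
    (hg₀ : g₀ 0 = 0) (hg₁ : g₁ 0 = 0) (hg₁' : g₁ 1 = 0)
    (hle : ∀ t ∈ Icc (0 : ℝ) 1, ∀ S : ℝ, ‖g₀ t‖ ≤ S → ‖g₁ t‖ ≤ S → ‖g₂ t‖ ≤ S →
      ‖g₃ t‖ ≤ κ * S) : g₂ 0 = 0 := by
  obtain ⟨t₀, ht₀, hmax⟩ := isCompact_Icc.exists_isMaxOn
    (nonempty_Icc.2 (zero_le_one (α := ℝ))) h₃.norm
  have b₃ : ∀ t ∈ Icc (0 : ℝ) 1, ‖g₃ t‖ ≤ ‖g₃ t₀‖ := fun t ht => hmax ht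
  have hint : ∫ t in (0 : ℝ)..1, g₂ t = 0 := by
    rw [intervalIntegral.integral_eq_sub_of_hasDerivAt (f := g₁), hg₁, hg₁', sub_zero]
    · rw [uIcc_of_le zero_le_one]; exact h₁
    · apply ContinuousOn.intervalIntegrable
      rw [uIcc_of_le zero_le_one]
      exact fun s hs => (h₂ s hs).continuousAt.continuousWithinAt
  have b₂ : ∀ t ∈ Icc (0 : ℝ) 1, ‖g₂ t‖ ≤ ‖g₃ t₀‖ := fun t ht =>
    norm_le_of_integral_eq_zero h₂ b₃ hint ht
  have b₁ : ∀ t ∈ Icc (0 : ℝ) 1, ‖g₁ t‖ ≤ ‖g₃ t₀‖ := fun t ht =>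
    norm_le_of_hasDerivAt_of_eq_zero h₁ b₂ hg₁ ht
  have b₀ : ∀ t ∈ Icc (0 : ℝ) 1, ‖g₀ t‖ ≤ ‖g₃ t₀‖ := fun t ht =>
    norm_le_of_hasDerivAt_of_eq_zero h₀ b₁ hg₀ ht
  have := hle t₀ ht₀ _ (b₀ _ ht₀) (b₁ _ ht₀) (b₂ _ ht₀)
  have h0 : ‖g₃ t₀‖ = 0 := by nlinarith [norm_nonneg (g₃ t₀)]
  have := b₂ 0 (left_mem_Icc.2 zero_le_one)
  rw [h0] at this
  exact norm_le_zero_iff.1 this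

lemma mem_disk {z : ℂ} : z ∈ disk ↔ ‖z‖ < 1 := by simp [disk]

/-- Two-fold zeros coincide if the coefficients, scaled by the powers of the distance, are small
on the segment between them. -/
lemma eq_of_mem_twoFoldZeros_of_small {A : Fin 3 → ℂ → ℂ} {f : ℂ → ℂ} (hf : IsSolution A f)
    {a b : ℂ} (ha : a ∈ twoFoldZeros f) (hb : b ∈ twoFoldZeros f) {κ : ℝ} (hκ : κ < 1)
    (hsmall : ∀ z ∈ segment ℝ a b,
      ∑ j : Fin 3, ‖A j z‖ * ‖b - a‖ ^ (3 - (j : ℕ)) ≤ κ) : a = b := by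
  by_contra hab
  have hf' := hf.1
  obtain ⟨fa0, fa1, fa2⟩ := derivatives_of_mem_twoFoldZeros hf' ha
  obtain ⟨fb0, fb1, fb2⟩ := derivatives_of_mem_twoFoldZeros hf' hb
  set h := b - a with hh
  let γ : ℝ → ℂ := fun t => a + t * h
  have hseg : ∀ t ∈ Icc (0 : ℝ) 1, γ t ∈ segment ℝ a b := by
    intro t ht
    rw [segment_eq_image']
    exact ⟨t, ht, by simp [γ, hh]⟩
  have hd : ∀ t ∈ Icc (0 : ℝ) 1, γ t ∈ disk := fun t ht =>
    (convex_ball (0 : ℂ) 1).segment_subset ha.1 hb.1 (hseg t ht)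
  have hγ : ∀ t : ℝ, HasDerivAt γ h t := by
    intro t
    simpa [γ] using ((Complex.ofRealCLM.hasDerivAt (x := t)).mul_const h).const_add a
  have hder : ∀ n : ℕ, ∀ t ∈ Icc (0 : ℝ) 1,
      HasDerivAt (fun t => h ^ n * iteratedDeriv n f (γ t))
        (h ^ (n + 1) * iteratedDeriv (n + 1) f (γ t)) t := by
    intro n t ht
    have := ((hasDerivAt_iteratedDeriv hf' n (hd t ht)).comp t (hγ t)).const_mul (h ^ n)
    rw [show h ^ (n + 1) * iteratedDeriv (n + 1) f (γ t)
      = h ^ n * (iteratedDeriv (n + 1) f (γ t) * h) by ring]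
    exact this
  have key := eq_zero_of_boundary_zeros hκ (hder 0) (hder 1) (hder 2)
    (fun t ht => (hder 3 t ht).continuousAt.continuousWithinAt)
    (by simp [γ, fa0]) (by simp only [γ]; simp [fa1])
    (by simp only [γ, hh, Complex.ofReal_one, one_mul, add_sub_cancel, fb1, mul_zero]) ?_
  · simp only [γ, Complex.ofReal_zero, zero_mul, add_zero, mul_eq_zero] at key
    rcases key with key | key
    · exact hab (sub_eq_zero.1 (pow_eq_zero_iff (by norm_num) |>.1 key)).symm
    · exact fa2 key
  · intro t ht S s0 s1 s2
    have ode := hf.2 (γ t) (hd t ht)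
    have hs := hsmall _ (hseg t ht)
    simp only [Fin.sum_univ_three, Fin.val_zero, Fin.val_one, Fin.val_two] at hs
    have hS0 : 0 ≤ S := (norm_nonneg _).trans s0
    have e3 : h ^ 3 * iteratedDeriv 3 f (γ t) =
        -((A 2 (γ t) * h) * (h ^ 2 * iteratedDeriv 2 f (γ t))
        + (A 1 (γ t) * h ^ 2) * (h ^ 1 * iteratedDeriv 1 f (γ t))
        + (A 0 (γ t) * h ^ 3) * (h ^ 0 * iteratedDeriv 0 f (γ t))) := by
      rw [← sub_eq_zero, iteratedDeriv_one, iteratedDeriv_zero]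
      linear_combination h ^ 3 * ode
    rw [e3, norm_neg]
    refine (norm_add₃_le).trans ?_
    rw [norm_mul, norm_mul (A 1 (γ t) * h ^ 2), norm_mul (A 0 (γ t) * h ^ 3)]
    rw [norm_mul (A 2 (γ t)), norm_mul (A 1 (γ t)), norm_mul (A 0 (γ t)), norm_pow h 3,
      norm_pow h 2]
    calc _ ≤ ‖A 2 (γ t)‖ * ‖h‖ * S + ‖A 1 (γ t)‖ * ‖h‖ ^ 2 * S + ‖A 0 (γ t)‖ * ‖h‖ ^ 3 * S := by
          gcongr
      _ = (‖A 0 (γ t)‖ * ‖h‖ ^ 3 + ‖A 1 (γ t)‖ * ‖h‖ ^ 2 + ‖A 2 (γ t)‖ * ‖h‖ ^ 1) * S := by ring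
      _ ≤ κ * S := by
          gcongr

theorem isSeparated_twoFoldZeros {A : Fin 3 → ℂ → ℂ} {f : ℂ → ℂ} (hf : IsSolution A f)
    (hA : ∀ j : Fin 3, BddAbove
      ((fun z : ℂ => ‖A j z‖ * (1 - ‖z‖ ^ 2) ^ (3 - (j : ℕ))) '' disk)) :
    IsSeparated (twoFoldZeros f) := by
  refine ⟨fun z hz => hz.1, ?_⟩
  choose M hM using hA
  set N : ℝ := 1 + ∑ j, |M j| with hN
  have hMN : ∀ j, ∀ z ∈ disk, ‖A j z‖ * (1 - ‖z‖ ^ 2) ^ (3 - (j : ℕ)) ≤ N := by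
    intro j z hz
    have h1 := hM j (mem_image_of_mem _ hz)
    have h2 : |M j| ≤ ∑ j, |M j| :=
      Finset.single_le_sum (f := fun j => |M j|) (fun i _ => abs_nonneg _) (Finset.mem_univ j)
    linarith [le_abs_self (M j)]
  have hN1 : 1 ≤ N := by
    have : 0 ≤ ∑ j, |M j| := Finset.sum_nonneg fun i _ => abs_nonneg _
    linarith
  -- small enough for the sum of the three scaled coefficients to be at most `24 * δ * N < 1`
  set δ : ℝ := 1 / (32 * N) with hδ
  have hδ0 : 0 < δ := by positivity
  have hδN : δ * N = 1 / 32 := by rw [hδ]; field_simp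
  have hδ1 : δ ≤ 1 / 32 := by nlinarith
  refine ⟨δ, hδ0, fun a ha b hb hab => ?_⟩
  by_contra hlt
  rw [not_lt] at hlt
  refine hab (eq_of_mem_twoFoldZeros_of_small hf ha hb (κ := 24 * (δ * N))
    (by rw [hδN]; norm_num) ?_)
  have ha1 := mem_disk.1 ha.1
  have hb1 := mem_disk.1 hb.1
  -- a small pseudo-hyperbolic distance forces `‖b - a‖` to be small against `1 - ‖a‖`
  have hba : ‖b - a‖ ≤ 4 * δ * (1 - ‖a‖) := by
    have hq : ‖1 - (starRingEnd ℂ) a * b‖ ≤ (1 - ‖a‖ ^ 2) + ‖b - a‖ := by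
      have e : 1 - (starRingEnd ℂ) a * b
          = ((1 - ‖a‖ ^ 2 : ℝ) : ℂ) - (starRingEnd ℂ) a * (b - a) := by
        have := Complex.conj_mul' a
        push_cast
        rw [mul_sub, this]; ring
      rw [e]
      refine (norm_sub_le _ _).trans ?_
      rw [Complex.norm_real, Real.norm_eq_abs, abs_of_nonneg (by nlinarith [norm_nonneg a]),
        norm_mul, RCLike.norm_conj]
      nlinarith [norm_nonneg (b - a)]
    have hq0 : 0 < ‖1 - (starRingEnd ℂ) a * b‖ := by
      rw [norm_pos_iff, sub_ne_zero]
      intro h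
      have : ‖(starRingEnd ℂ) a * b‖ = 1 := by rw [← h]; simp
      rw [norm_mul, RCLike.norm_conj] at this
      nlinarith [norm_nonneg a, norm_nonneg b]
    unfold pseudoDist at hlt
    rw [div_le_iff₀ hq0, norm_sub_rev] at hlt
    have : ‖b - a‖ ≤ δ * ((1 - ‖a‖ ^ 2) + ‖b - a‖) := hlt.trans (by gcongr)
    have h3 : 1 - ‖a‖ ^ 2 ≤ 2 * (1 - ‖a‖) := by nlinarith [norm_nonneg a]
    nlinarith [norm_nonneg (b - a)]
  intro z hz
  have hzd : z ∈ disk := (convex_ball (0 : ℂ) 1).segment_subset ha.1 hb.1 hz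
  have hza : ‖z - a‖ ≤ ‖b - a‖ := by
    rw [segment_eq_image'] at hz
    obtain ⟨t, ht, rfl⟩ := hz
    simp only [add_sub_cancel_left, norm_smul, Real.norm_eq_abs, abs_of_nonneg ht.1]
    nlinarith [norm_nonneg (b - a), ht.2]
  have hz1 := mem_disk.1 hzd
  have hbz : ‖b - a‖ ≤ 8 * δ * (1 - ‖z‖ ^ 2) := by
    have h1 : ‖z‖ ≤ ‖a‖ + ‖z - a‖ := by
      simpa using norm_add_le a (z - a)
    have h2 : (1 - ‖a‖) ≤ 2 * (1 - ‖z‖) := by nlinarith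
    have h3 : 1 - ‖z‖ ≤ 1 - ‖z‖ ^ 2 := by nlinarith [norm_nonneg z]
    nlinarith
  have hterm : ∀ j : Fin 3, ‖A j z‖ * ‖b - a‖ ^ (3 - (j : ℕ)) ≤ 8 * (δ * N) := by
    intro j
    have hw : 0 ≤ 1 - ‖z‖ ^ 2 := by nlinarith [norm_nonneg z]
    calc ‖A j z‖ * ‖b - a‖ ^ (3 - (j : ℕ))
        ≤ ‖A j z‖ * (8 * δ * (1 - ‖z‖ ^ 2)) ^ (3 - (j : ℕ)) := by gcongr
      _ = (8 * δ) ^ (3 - (j : ℕ)) * (‖A j z‖ * (1 - ‖z‖ ^ 2) ^ (3 - (j : ℕ))) := by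
          rw [mul_pow]; ring
      _ ≤ (8 * δ) ^ 1 * N := by
          have hj : 1 ≤ 3 - (j : ℕ) := by omega
          refine mul_le_mul (pow_le_pow_of_le_one (by positivity) (by linarith) hj)
            (hMN j z hzd) (by positivity) (by positivity)
      _ = 8 * (δ * N) := by ring
  calc _ ≤ ∑ _j : Fin 3, 8 * (δ * N) := Finset.sum_le_sum fun j _ => hterm j
    _ = 24 * (δ * N) := by simp; ring

/-! ### Disc automorphisms -/

lemma measurableSet_disk : MeasurableSet disk := Metric.isOpen_ball.measurableSet

lemma one_sub_conj_mul_ne_zero {a z : ℂ} (ha : a ∈ disk) (hz : z ∈ disk) :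
    1 - conj a * z ≠ 0 := by
  rw [sub_ne_zero]
  intro h
  have : ‖conj a * z‖ = 1 := by rw [← h]; simp
  rw [norm_mul, RCLike.norm_conj] at this
  nlinarith [norm_nonneg a, norm_nonneg z, mem_disk.1 ha, mem_disk.1 hz]

lemma one_sub_normSq_pos {a : ℂ} (ha : a ∈ disk) : 0 < 1 - ‖a‖ ^ 2 := by
  nlinarith [norm_nonneg a, mem_disk.1 ha]

lemma one_sub_norm_diskAut_sq {a z : ℂ} (ha : a ∈ disk) (hz : z ∈ disk) :
    1 - ‖diskAut a z‖ ^ 2 = (1 - ‖a‖ ^ 2) * (1 - ‖z‖ ^ 2) / ‖1 - conj a * z‖ ^ 2 := by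
  have hq := norm_ne_zero_iff.2 (one_sub_conj_mul_ne_zero ha hz)
  rw [diskAut, norm_div, div_pow, eq_div_iff (pow_ne_zero 2 hq), sub_mul,
    div_mul_cancel₀ _ (pow_ne_zero 2 hq)]
  rw [← Complex.ofReal_inj]
  push_cast
  simp only [← Complex.conj_mul', map_sub, map_mul, map_one, Complex.conj_conj]
  ring

lemma diskAut_mem_disk {a z : ℂ} (ha : a ∈ disk) (hz : z ∈ disk) : diskAut a z ∈ disk := by
  have h := one_sub_norm_diskAut_sq ha hz
  have : 0 < 1 - ‖diskAut a z‖ ^ 2 := by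
    rw [h]
    have := norm_pos_iff.2 (one_sub_conj_mul_ne_zero ha hz)
    have := one_sub_normSq_pos ha
    have := one_sub_normSq_pos hz
    positivity
  rw [mem_disk]
  nlinarith [norm_nonneg (diskAut a z)]

lemma one_sub_conj_mul_self_ne_zero {a : ℂ} (ha : a ∈ disk) : 1 - conj a * a ≠ 0 :=
  one_sub_conj_mul_ne_zero ha ha

lemma diskAut_diskAut {a z : ℂ} (ha : a ∈ disk) (hz : z ∈ disk) :
    diskAut a (diskAut a z) = z := by
  have hq := one_sub_conj_mul_ne_zero ha hz
  have hq' := one_sub_conj_mul_ne_zero ha (diskAut_mem_disk ha hz)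
  have hp : (1 - conj a * z) * diskAut a z = a - z := by rw [diskAut]; field_simp
  rw [diskAut, div_eq_iff hq']
  refine mul_left_cancel₀ hq ?_
  linear_combination (conj a * z - 1) * hp

/-- The derivative of `diskAut a`. -/
noncomputable def diskAutDeriv (a z : ℂ) : ℂ := -(1 - conj a * a) / (1 - conj a * z) ^ 2

lemma hasDerivAt_diskAut {a z : ℂ} (ha : a ∈ disk) (hz : z ∈ disk) :
    HasDerivAt (diskAut a) (diskAutDeriv a z) z := by
  have hq := one_sub_conj_mul_ne_zero ha hz
  have h1 : HasDerivAt (fun z => a - z) (-1) z := by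
    simpa using (hasDerivAt_id z).const_sub a
  have h2 : HasDerivAt (fun z => 1 - conj a * z) (-conj a) z := by
    simpa using ((hasDerivAt_id z).const_mul (conj a)).const_sub 1
  refine (h1.fun_div h2 hq).congr_deriv ?_
  unfold diskAutDeriv
  congr 1
  ring

lemma norm_diskAutDeriv_mul {a z : ℂ} (ha : a ∈ disk) (hz : z ∈ disk) :
    ‖diskAutDeriv a z‖ * (1 - ‖z‖ ^ 2) = 1 - ‖diskAut a z‖ ^ 2 := by
  rw [one_sub_norm_diskAut_sq ha hz, diskAutDeriv, norm_div, norm_neg, norm_pow,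
    Complex.conj_mul']
  have : ‖1 - (‖a‖ : ℂ) ^ 2‖ = 1 - ‖a‖ ^ 2 := by
    rw [← Complex.ofReal_pow, ← Complex.ofReal_one, ← Complex.ofReal_sub, Complex.norm_real,
      Real.norm_of_nonneg (one_sub_normSq_pos ha).le]
  rw [this]
  ring

lemma diskAutDeriv_ne_zero {a z : ℂ} (ha : a ∈ disk) (hz : z ∈ disk) : diskAutDeriv a z ≠ 0 :=
  div_ne_zero (neg_ne_zero.2 (one_sub_conj_mul_self_ne_zero ha))
    (pow_ne_zero 2 (one_sub_conj_mul_ne_zero ha hz))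

lemma differentiableOn_diskAut {a : ℂ} (ha : a ∈ disk) : DifferentiableOn ℂ (diskAut a) disk :=
  fun _ hz => (hasDerivAt_diskAut ha hz).differentiableAt.differentiableWithinAt

lemma differentiableOn_diskAutDeriv {a : ℂ} (ha : a ∈ disk) :
    DifferentiableOn ℂ (diskAutDeriv a) disk := by
  unfold diskAutDeriv
  exact (differentiableOn_const _).div (by fun_prop)
    fun z hz => pow_ne_zero 2 (one_sub_conj_mul_ne_zero ha hz)

lemma injOn_diskAut {a : ℂ} (ha : a ∈ disk) : InjOn (diskAut a) disk := fun z hz w hw h => by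
  rw [← diskAut_diskAut ha hz, h, diskAut_diskAut ha hw]

lemma image_diskAut {a : ℂ} (ha : a ∈ disk) : diskAut a '' disk = disk := by
  refine Subset.antisymm (image_subset_iff.2 fun z hz => diskAut_mem_disk ha hz) fun z hz => ?_
  exact ⟨diskAut a z, diskAut_mem_disk ha hz, diskAut_diskAut ha hz⟩

lemma pseudoDist_eq_norm_diskAut (z a : ℂ) : pseudoDist z a = ‖diskAut a z‖ := by
  rw [pseudoDist, diskAut, norm_div, norm_sub_rev, ← RCLike.norm_conj (1 - conj z * a)]
  simp [mul_comm]

/-- Change of variables `w = diskAut a z` in an area integral over the disc. -/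
lemma lintegral_comp_diskAut {a : ℂ} (ha : a ∈ disk) (g : ℂ → ENNReal) :
    ∫⁻ w in disk, g w =
      ∫⁻ z in disk, ENNReal.ofReal (‖diskAutDeriv a z‖ ^ 2) * g (diskAut a z) := by
  have h := lintegral_image_eq_lintegral_abs_det_fderiv_mul volume
    (s := disk) (f := diskAut a)
    (f' := fun z => ((ContinuousLinearMap.toSpanSingleton ℂ (diskAutDeriv a z)).restrictScalars ℝ))
    measurableSet_disk
    (fun z hz => ((hasDerivAt_diskAut ha hz).hasFDerivAt.restrictScalars ℝ).hasFDerivWithinAt)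
    (injOn_diskAut ha) g
  rw [image_diskAut ha] at h
  rw [h]
  congr 1
  ext z
  congr 2
  rw [ContinuousLinearMap.det, ContinuousLinearMap.coe_restrictScalars,
    LinearMap.det_restrictScalars]
  simp [Algebra.norm_complex_apply, Complex.normSq_eq_norm_sq]

/-! ### The transported coefficients and polar coordinates -/

/-- The coefficient `A j`, transported by `diskAut a`. With `B j` for these functions and
`p = φ_a'' / φ_a'`, the coefficients of the equation for `(f ∘ φ_a) / φ_a'` are `B 2`,
`B 1 + p * B 2` and `B 0 + p * B 1 + p ^ 2 / 2 * B 2`. -/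
noncomputable def pullbackCoeff (A : Fin 3 → ℂ → ℂ) (a : ℂ) (j : Fin 3) (z : ℂ) : ℂ :=
  A j (diskAut a z) * diskAutDeriv a z ^ (3 - (j : ℕ))

lemma differentiableOn_pullbackCoeff {A : Fin 3 → ℂ → ℂ}
    (hA : ∀ j, DifferentiableOn ℂ (A j) disk) {a : ℂ} (ha : a ∈ disk) (j : Fin 3) :
    DifferentiableOn ℂ (pullbackCoeff A a j) disk :=
  ((hA j).comp (differentiableOn_diskAut ha) fun _ hz => diskAut_mem_disk ha hz).mul
    ((differentiableOn_diskAutDeriv ha).pow _)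

/-- The Carleson integral of `A j` with respect to `a` is the weighted area integral of the
transported coefficient. -/
lemma lintegral_pullbackCoeff (A : Fin 3 → ℂ → ℂ) {a : ℂ} (ha : a ∈ disk) (j : Fin 3) :
    ∫⁻ z in disk, ENNReal.ofReal
        (‖A j z‖ * (1 - ‖z‖ ^ 2) ^ (1 - ((j : ℕ) : ℤ)) * (1 - ‖diskAut a z‖ ^ 2))
      = ∫⁻ z in disk, ENNReal.ofReal
        (‖pullbackCoeff A a j z‖ * (1 - ‖z‖ ^ 2) ^ (2 - (j : ℕ))) := by
  rw [lintegral_comp_diskAut ha]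
  refine setLIntegral_congr_fun measurableSet_disk fun z hz => ?_
  rw [← ENNReal.ofReal_mul (by positivity), diskAut_diskAut ha hz, ← norm_diskAutDeriv_mul ha hz,
    pullbackCoeff, norm_mul, norm_pow]
  have hs := (one_sub_normSq_pos hz).ne'
  have hd := norm_ne_zero_iff.2 (diskAutDeriv_ne_zero ha hz)
  generalize 1 - ‖z‖ ^ 2 = s at *
  generalize ‖diskAutDeriv a z‖ = d at *
  congr 1
  fin_cases j
  · simp; ring
  · simp; ring
  · norm_num
    field_simp

/-- The sum of the transported coefficients, weighted by `(1 - ‖z‖ ^ 2) ^ (2 - j)`. Its area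
integral is the sum of the Carleson integrals with respect to `a`, and its radial integrals govern the growth
of the transported solution. -/
noncomputable def density (A : Fin 3 → ℂ → ℂ) (a z : ℂ) : ℝ :=
  ∑ j : Fin 3, ‖pullbackCoeff A a j z‖ * (1 - ‖z‖ ^ 2) ^ (2 - (j : ℕ))

lemma density_nonneg (A : Fin 3 → ℂ → ℂ) (a : ℂ) {z : ℂ} (hz : z ∈ disk) : 0 ≤ density A a z :=
  Finset.sum_nonneg fun _ _ => mul_nonneg (norm_nonneg _) (pow_nonneg (one_sub_normSq_pos hz).le _)

lemma continuousOn_density {A : Fin 3 → ℂ → ℂ} (hA : ∀ j, DifferentiableOn ℂ (A j) disk) {a : ℂ}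
    (ha : a ∈ disk) : ContinuousOn (density A a) disk :=
  continuousOn_finsetSum _ fun j _ =>
    ((differentiableOn_pullbackCoeff hA ha j).continuousOn.norm).mul (by fun_prop)

lemma measurable_indicator_of_continuousOn {s : Set ℂ} {F : ℂ → ENNReal} (hs : MeasurableSet s)
    (hF : ContinuousOn F s) : Measurable (s.indicator F) := by
  classical
  have := hF.measurable_piecewise (g := 0) continuousOn_const hs
  rwa [piecewise_eq_indicator] at this

/-- Integration in polar coordinates, as an iterated integral. -/
lemma lintegral_polar {F : ℂ → ENNReal} (hF : Measurable F) :
    ∫⁻ θ in Ioo (-π) π, ∫⁻ s in Ioi (0 : ℝ), ENNReal.ofReal s * F (circleMap 0 s θ) =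
      ∫⁻ z, F z := by
  rw [← Complex.lintegral_comp_polarCoord_symm, polarCoord_target, Measure.volume_eq_prod,
    ← Measure.prod_restrict, lintegral_prod_symm]
  · simp only [Complex.polarCoord_symm_apply, smul_eq_mul, circleMap, zero_add, Complex.exp_mul_I,
      Complex.ofReal_cos, Complex.ofReal_sin]
  · apply Measurable.aemeasurable
    have : Measurable fun p : ℝ × ℝ => Complex.polarCoord.symm p := by
      simp only [Complex.polarCoord_symm_apply]
      fun_prop
    exact (by fun_prop : Measurable fun p : ℝ × ℝ => ENNReal.ofReal p.1).mul (hF.comp this)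

lemma lintegral_polar_radius_first {F : ℂ → ENNReal} (hF : Measurable F) :
    ∫⁻ s in Ioi (0 : ℝ), ENNReal.ofReal s * ∫⁻ θ in Ioo (-π) π, F (circleMap 0 s θ) =
      ∫⁻ z, F z := by
  rw [← lintegral_polar hF, lintegral_lintegral_swap]
  · refine lintegral_congr fun s => ?_
    exact (lintegral_const_mul _ (hF.comp (continuous_circleMap 0 s).measurable)).symm
  · apply Measurable.aemeasurable
    have : Measurable fun p : ℝ × ℝ => circleMap 0 p.2 p.1 := by
      unfold circleMap; fun_prop
    exact (by fun_prop : Measurable fun p : ℝ × ℝ => ENNReal.ofReal p.2).mul (hF.comp this)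

lemma integral_circleMap_symm {E : Type*} [NormedAddCommGroup E] [NormedSpace ℝ E]
    (g : ℂ → E) (s : ℝ) :
    ∫ θ in (0 : ℝ)..2 * π, g (circleMap 0 s θ) = ∫ θ in (-π)..π, g (circleMap 0 s θ) := by
  have hp : Function.Periodic (fun θ => g (circleMap 0 s θ)) (2 * π) := fun θ => by
    simp only [periodic_circleMap 0 s θ]
  have := hp.intervalIntegral_add_eq 0 (-π)
  rwa [zero_add, show -π + 2 * π = π by ring] at this

/-- The mean value property bounds an analytic function at the centre by its area integral. -/
lemma norm_zero_le_lintegral {G : ℂ → ℂ} (hG : DifferentiableOn ℂ G disk) :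
    ENNReal.ofReal ‖G 0‖ ≤ 16 * ∫⁻ z in Metric.ball 0 (1 / 2), ENNReal.ofReal ‖G z‖ := by
  have hsub : Metric.ball (0 : ℂ) (1 / 2) ⊆ disk := Metric.ball_subset_ball (by norm_num)
  have hmeas : Measurable ((Metric.ball (0 : ℂ) (1 / 2)).indicator
      fun z => ENNReal.ofReal ‖G z‖) := by
    have h : ContinuousOn (fun z => ENNReal.ofReal ‖G z‖) (Metric.ball (0 : ℂ) (1 / 2)) :=
      ENNReal.continuous_ofReal.comp_continuousOn (hG.continuousOn.norm.mono hsub)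
    exact measurable_indicator_of_continuousOn measurableSet_ball h
  rw [← lintegral_indicator measurableSet_ball, ← lintegral_polar_radius_first hmeas]
  have hcirc : ∀ s ∈ Ioo (1 / 4 : ℝ) (1 / 2), ENNReal.ofReal (2 * π * ‖G 0‖) ≤
      ∫⁻ θ in Ioo (-π) π, (Metric.ball (0 : ℂ) (1 / 2)).indicator
        (fun z => ENNReal.ofReal ‖G z‖) (circleMap 0 s θ) := by
    intro s hs
    have hs0 : 0 < s := by linarith [hs.1]
    have hmem : ∀ θ, circleMap 0 s θ ∈ Metric.ball (0 : ℂ) (1 / 2) := fun θ => by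
      simpa [abs_of_pos hs0] using hs.2
    simp only [indicator_of_mem (hmem _)]
    have hcont : Continuous fun θ => G (circleMap 0 s θ) := by
      have h1 : ContinuousOn G disk := hG.continuousOn
      exact h1.comp_continuous (continuous_circleMap 0 s) fun θ => hsub (hmem θ)
    have hav : Real.circleAverage G 0 s = G 0 := by
      apply DiffContOnCl.circleAverage
      refine (hG.mono ?_).diffContOnCl
      rw [abs_of_pos hs0, closure_ball _ hs0.ne']
      exact Metric.closedBall_subset_ball (by linarith [hs.2])
    have e : 2 * π * ‖G 0‖ = ‖∫ θ in (-π)..π, G (circleMap 0 s θ)‖ := by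
      rw [← hav, Real.circleAverage, integral_circleMap_symm, norm_smul, Real.norm_eq_abs,
        abs_of_pos (by positivity)]
      field_simp
    rw [e, intervalIntegral.integral_of_le (by linarith [Real.pi_pos]),
      ← restrict_Ioo_eq_restrict_Ioc, ofReal_norm]
    simp only [ofReal_norm]
    exact enorm_integral_le_lintegral_enorm _
  calc ENNReal.ofReal ‖G 0‖
      ≤ 16 * (ENNReal.ofReal (1 / 4) * ENNReal.ofReal (2 * π * ‖G 0‖) *
        ENNReal.ofReal (1 / 4)) := by
        rw [← ENNReal.ofReal_mul (by norm_num), ← ENNReal.ofReal_mul (by positivity),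
          ← ENNReal.ofReal_ofNat, ← ENNReal.ofReal_mul (by norm_num)]
        apply ENNReal.ofReal_le_ofReal
        nlinarith [norm_nonneg (G 0), Real.pi_gt_three]
    _ = 16 * ∫⁻ s in Ioo (1 / 4 : ℝ) (1 / 2),
          (ENNReal.ofReal (1 / 4) * ENNReal.ofReal (2 * π * ‖G 0‖)) := by
        rw [setLIntegral_const, Real.volume_Ioo]
        norm_num
    _ ≤ _ := by
        gcongr 16 * ?_
        refine (setLIntegral_mono' measurableSet_Ioo fun s hs => ?_).trans
          (lintegral_mono_set (Ioo_subset_Ioi_self.trans (Ioi_subset_Ioi (by norm_num))))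
        exact mul_le_mul' (ENNReal.ofReal_le_ofReal hs.1.le) (hcirc s hs)

/-! ### Gronwall estimates along a radius -/

/-- Gronwall's inequality with a variable coefficient. -/
lemma gronwall_le {X X' κ : ℝ → ℝ} {T : ℝ} (hT : 0 ≤ T) (hκ : ContinuousOn κ (Icc 0 T))
    (hXc : ContinuousOn X (Icc 0 T))
    (hX : ∀ t ∈ Ioo 0 T, HasDerivAt X (X' t) t) (hle : ∀ t ∈ Ioo 0 T, X' t ≤ κ t * X t) :
    X T ≤ X 0 * Real.exp (∫ t in (0 : ℝ)..T, κ t) := by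
  set Φ : ℝ → ℝ := fun t => ∫ s in (0 : ℝ)..t, κ s with hΦ
  have hii : IntegrableOn κ (Icc 0 T) := hκ.integrableOn_Icc
  have hΦc : ContinuousOn Φ (Icc 0 T) := by
    have := intervalIntegral.continuousOn_primitive_interval
      (μ := volume) (f := κ) (a := 0) (b := T)
      (by rwa [uIcc_of_le hT])
    rwa [uIcc_of_le hT] at this
  have hΦd : ∀ t ∈ Ioo 0 T, HasDerivAt Φ (κ t) t := by
    intro t ht
    refine intervalIntegral.integral_hasDerivAt_right ?_ ?_ ?_
    · refine (hκ.mono ?_).intervalIntegrable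
      rw [uIcc_of_le ht.1.le]
      exact Icc_subset_Icc_right ht.2.le
    · exact (hκ.mono Ioo_subset_Icc_self).stronglyMeasurableAtFilter isOpen_Ioo t ht
    · exact hκ.continuousAt (Icc_mem_nhds ht.1 ht.2)
  have hanti : AntitoneOn (fun t => X t * Real.exp (-Φ t)) (Icc 0 T) := by
    apply antitoneOn_of_deriv_nonpos (convex_Icc 0 T)
    · exact hXc.mul (Real.continuous_exp.comp_continuousOn hΦc.neg)
    · rw [interior_Icc]
      intro t ht
      exact ((hX t ht).mul (hΦd t ht).neg.exp).differentiableAt.differentiableWithinAt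
    · rw [interior_Icc]
      intro t ht
      have h := (hX t ht).mul (hΦd t ht).neg.exp
      rw [show (fun t => X t * Real.exp (-Φ t)) = X * fun x => Real.exp ((-Φ) x) from rfl, h.deriv]
      have := hle t ht
      have h2 := Real.exp_pos ((-Φ) t)
      nlinarith
  have := hanti (left_mem_Icc.2 hT) (right_mem_Icc.2 hT) hT
  simp only [hΦ, intervalIntegral.integral_same, neg_zero, Real.exp_zero, mul_one] at this
  rw [Real.exp_neg, ← div_eq_mul_inv, div_le_iff₀ (Real.exp_pos _)] at this
  exact this

/-- Growth of a solution of a third order equation along a radius. The quantities followed by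
Gronwall's lemma are the value and the derivatives at the boundary point `1` of the Taylor
polynomial of `u₀` at `t`: their derivatives in `t` involve `u₃` alone, with the right power of
`1 - t`. -/
lemma norm_le_exp_of_third_order {u₀ u₁ u₂ u₃ : ℝ → ℂ} {κ : ℝ → ℝ} {T : ℝ}
    (hT : 0 ≤ T) (hT1 : T < 1)
    (hκ : ContinuousOn κ (Icc 0 T)) (hκ0 : ∀ t ∈ Icc 0 T, 0 ≤ κ t)
    (h₀ : ∀ t ∈ Icc 0 T, HasDerivAt u₀ (u₁ t) t)
    (h₁ : ∀ t ∈ Icc 0 T, HasDerivAt u₁ (u₂ t) t)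
    (h₂ : ∀ t ∈ Icc 0 T, HasDerivAt u₂ (u₃ t) t)
    (h₃ : ContinuousOn u₃ (Icc 0 T)) (hu₀ : u₀ 0 = 0) (hu₁ : u₁ 0 = 0)
    (hle : ∀ t ∈ Icc 0 T, (1 - t) ^ 2 * ‖u₃ t‖ ≤
      κ t * (‖u₀ t‖ + (1 - t) * ‖u₁ t‖ + (1 - t) ^ 2 * ‖u₂ t‖)) :
    ‖u₀ T‖ ≤ 4 * ‖u₂ 0‖ * Real.exp (7 * ∫ t in (0 : ℝ)..T, κ t) := by
  set w : ℝ → ℝ := fun t => (1 - t) ^ 2 * ‖u₃ t‖ with hw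
  have hwc : ContinuousOn w (Icc 0 T) :=
    (by fun_prop : Continuous fun t : ℝ => (1 - t) ^ 2).continuousOn.mul h₃.norm
  set X : ℝ → ℝ := fun t => ‖u₂ 0‖ + ∫ s in (0 : ℝ)..t, w s with hX
  have hsub : ∀ {t}, t ∈ Icc 0 T → Icc 0 t ⊆ Icc 0 T := fun ht => Icc_subset_Icc_right ht.2
  -- the common estimate for the value and the derivatives at `1` of the Taylor polynomial of `u₀`
  -- at `t`: `e` is one of them, `p t * u₃ t` its derivative, and `k` the weight `(1 - t) ^ i`
  have hint : ∀ (p : ℝ → ℝ) (e : ℝ → ℂ) (k : ℝ), Continuous p → (∀ t ∈ Icc 0 T,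
      HasDerivAt e (p t * u₃ t) t) → ‖e 0‖ ≤ ‖u₂ 0‖ → ∀ t ∈ Icc 0 T, 0 ≤ k → k ≤ 1 →
      (∀ s ∈ Icc 0 t, k * |p s| ≤ (1 - s) ^ 2) → k * ‖e t‖ ≤ X t := by
    intro p e k hp he he0 t ht hk hk1 hkp
    have hii : ContinuousOn (fun s => (p s : ℂ) * u₃ s) (Icc 0 t) :=
      (Complex.continuous_ofReal.comp hp).continuousOn.mul (h₃.mono (hsub ht))
    have e1 : e t = e 0 + ∫ s in (0 : ℝ)..t, (p s : ℂ) * u₃ s := by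
      rw [intervalIntegral.integral_eq_sub_of_hasDerivAt (f := e)]
      · ring
      · rw [uIcc_of_le ht.1]
        exact fun s hs => he s (hsub ht hs)
      · exact ContinuousOn.intervalIntegrable (by rwa [uIcc_of_le ht.1])
    have e2 : ‖∫ s in (0 : ℝ)..t, (p s : ℂ) * u₃ s‖ ≤ ∫ s in (0 : ℝ)..t, ‖(p s : ℂ) * u₃ s‖ :=
      intervalIntegral.norm_integral_le_integral_norm ht.1
    have e3 : k * ∫ s in (0 : ℝ)..t, ‖(p s : ℂ) * u₃ s‖ ≤ ∫ s in (0 : ℝ)..t, w s := by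
      rw [← intervalIntegral.integral_const_mul]
      apply intervalIntegral.integral_mono_on ht.1
      · exact ContinuousOn.intervalIntegrable (by
          rw [uIcc_of_le ht.1]; exact continuousOn_const.mul hii.norm)
      · exact ContinuousOn.intervalIntegrable (by
          rw [uIcc_of_le ht.1]; exact hwc.mono (hsub ht))
      · intro s hs
        rw [norm_mul, Complex.norm_real, Real.norm_eq_abs, ← mul_assoc]
        exact mul_le_mul_of_nonneg_right (hkp s hs) (norm_nonneg _)
    calc k * ‖e t‖ ≤ k * (‖e 0‖ + ∫ s in (0 : ℝ)..t, ‖(p s : ℂ) * u₃ s‖) := by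
          rw [e1]; gcongr; exact (norm_add_le _ _).trans (by gcongr)
      _ ≤ X t := by
          rw [mul_add]
          refine add_le_add ?_ e3
          nlinarith [norm_nonneg (e 0)]
  have hone : ∀ t : ℝ, HasDerivAt (fun t : ℝ => ((1 - t : ℝ) : ℂ)) (-1) t := by
    intro t
    have := ((hasDerivAt_id t).const_sub 1).ofReal_comp
    simpa using this
  have b2 : ∀ t ∈ Icc 0 T, (1 - t) ^ 2 * ‖u₂ t‖ ≤ X t := by
    intro t ht
    refine hint (fun _ => 1) u₂ _ continuous_const (fun t ht => by simpa using h₂ t ht) le_rfl t ht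
      (by positivity) (by nlinarith [ht.1, ht.2]) fun s hs => ?_
    rw [abs_one, mul_one]
    nlinarith [hs.1, hs.2, ht.2]
  have b1 : ∀ t ∈ Icc 0 T, (1 - t) * ‖u₁ t + ((1 - t : ℝ) : ℂ) * u₂ t‖ ≤ X t := by
    intro t ht
    refine hint (fun s => 1 - s) (fun t => u₁ t + ((1 - t : ℝ) : ℂ) * u₂ t) _ (by fun_prop)
      (fun t ht => ?_) (by simp [hu₁]) t ht (by linarith [ht.2]) (by linarith [ht.1]) fun s hs => ?_
    · refine ((h₁ t ht).fun_add ((hone t).fun_mul (h₂ t ht))).congr_deriv ?_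
      ring
    · rw [abs_of_nonneg (by linarith [hs.2, ht.2])]
      nlinarith [hs.1, hs.2, ht.2]
  have b0 : ∀ t ∈ Icc 0 T, ‖u₀ t + ((1 - t : ℝ) : ℂ) * u₁ t + ((1 - t : ℝ) : ℂ) ^ 2 / 2 * u₂ t‖
      ≤ X t := by
    intro t ht
    have := hint (fun s => (1 - s) ^ 2 / 2)
      (fun t => u₀ t + ((1 - t : ℝ) : ℂ) * u₁ t + ((1 - t : ℝ) : ℂ) ^ 2 / 2 * u₂ t) 1 (by fun_prop)
      (fun t ht => ?_) ?_ t ht (by norm_num) le_rfl fun s hs => ?_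
    · simpa only [one_mul] using this
    · refine (((h₀ t ht).fun_add ((hone t).fun_mul (h₁ t ht))).fun_add
        ((((hone t).fun_pow 2).div_const 2).fun_mul (h₂ t ht))).congr_deriv ?_
      push_cast
      ring
    · simp only [hu₀, hu₁, mul_zero, zero_add, sub_zero, norm_mul]
      norm_num
      linarith [norm_nonneg (u₂ 0)]
    · rw [abs_of_nonneg (by positivity)]
      nlinarith [sq_nonneg (1 - s)]
  have hnorm : ∀ t ∈ Icc 0 T, ‖((1 - t : ℝ) : ℂ)‖ = 1 - t := fun t ht => by
    rw [Complex.norm_real, Real.norm_of_nonneg (by linarith [ht.2])]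
  have c1 : ∀ t ∈ Icc 0 T, (1 - t) * ‖u₁ t‖ ≤ 2 * X t := by
    intro t ht
    have h : ‖u₁ t‖ ≤ ‖u₁ t + ((1 - t : ℝ) : ℂ) * u₂ t‖ + (1 - t) * ‖u₂ t‖ := by
      have := norm_sub_le (u₁ t + ((1 - t : ℝ) : ℂ) * u₂ t) (((1 - t : ℝ) : ℂ) * u₂ t)
      rwa [add_sub_cancel_right, norm_mul _ (u₂ t), hnorm t ht] at this
    have := b1 t ht
    have := b2 t ht
    have h1t : 0 ≤ 1 - t := by linarith [ht.2]
    nlinarith [mul_le_mul_of_nonneg_left h h1t]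
  have c0 : ∀ t ∈ Icc 0 T, ‖u₀ t‖ ≤ 4 * X t := by
    intro t ht
    have h1 := norm_sub_le (u₀ t + ((1 - t : ℝ) : ℂ) * u₁ t + ((1 - t : ℝ) : ℂ) ^ 2 / 2 * u₂ t)
      (((1 - t : ℝ) : ℂ) * u₁ t + ((1 - t : ℝ) : ℂ) ^ 2 / 2 * u₂ t)
    rw [show (u₀ t + ((1 - t : ℝ) : ℂ) * u₁ t + ((1 - t : ℝ) : ℂ) ^ 2 / 2 * u₂ t) -
      (((1 - t : ℝ) : ℂ) * u₁ t + ((1 - t : ℝ) : ℂ) ^ 2 / 2 * u₂ t) = u₀ t by ring] at h1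
    have h2 := norm_add_le (((1 - t : ℝ) : ℂ) * u₁ t) (((1 - t : ℝ) : ℂ) ^ 2 / 2 * u₂ t)
    rw [norm_mul, norm_mul, norm_div, norm_pow, hnorm t ht, Complex.norm_ofNat] at h2
    have := b0 t ht
    have := b2 t ht
    have := c1 t ht
    have : 0 ≤ X t := (by positivity : 0 ≤ (1 - t) ^ 2 * ‖u₂ t‖).trans (b2 t ht)
    linarith
  have hwi : IntegrableOn w (Icc 0 T) := hwc.integrableOn_Icc
  have hXc : ContinuousOn X (Icc 0 T) := by
    have := intervalIntegral.continuousOn_primitive_interval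
      (μ := volume) (f := w) (a := 0) (b := T)
      (by rwa [uIcc_of_le hT])
    rw [uIcc_of_le hT] at this
    exact continuousOn_const.add this
  have hXd : ∀ t ∈ Ioo 0 T, HasDerivAt X (w t) t := by
    intro t ht
    refine (intervalIntegral.integral_hasDerivAt_right ?_ ?_ ?_).const_add _
    · refine (hwc.mono ?_).intervalIntegrable
      rw [uIcc_of_le ht.1.le]
      exact Icc_subset_Icc_right ht.2.le
    · exact (hwc.mono Ioo_subset_Icc_self).stronglyMeasurableAtFilter isOpen_Ioo t ht
    · exact hwc.continuousAt (Icc_mem_nhds ht.1 ht.2)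
  have hfin := gronwall_le hT (hκ.const_smul (7 : ℝ)) hXc hXd fun t ht => by
    have ht' := Ioo_subset_Icc_self ht
    have h1 := hle t ht'
    have h2 : κ t * (‖u₀ t‖ + (1 - t) * ‖u₁ t‖ + (1 - t) ^ 2 * ‖u₂ t‖) ≤ κ t * (7 * X t) :=
      mul_le_mul_of_nonneg_left (by linarith [c0 t ht', c1 t ht', b2 t ht']) (hκ0 t ht')
    simp only [hw, smul_eq_mul, Pi.smul_apply]
    linarith
  have hX0 : X 0 = ‖u₂ 0‖ := by simp [hX]
  simp only [smul_eq_mul, Pi.smul_apply, intervalIntegral.integral_const_mul, hX0] at hfin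
  have := c0 T (right_mem_Icc.2 hT)
  linarith

/-! ### The transported equation -/

/-- The size of the third derivative in the transported equation, where `p = φ_a'' / φ_a'`
has at most the growth `2 / (1 - ‖z‖)`. -/
lemma weighted_norm_le (B₀ B₁ B₂ g₀ g₁ g₂ p : ℂ) {s W : ℝ} (hs : 0 ≤ s) (hsW : s ≤ W)
    (hps : s * ‖p‖ ≤ 2) :
    s ^ 2 * ‖B₀ * g₀ + B₁ * (g₁ + p * g₀) + B₂ * (g₂ + p * g₁ + p ^ 2 / 2 * g₀)‖ ≤
      2 * (‖B₀‖ * W ^ 2 + ‖B₁‖ * W + ‖B₂‖) * (‖g₀‖ + s * ‖g₁‖ + s ^ 2 * ‖g₂‖) := by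
  have n1 : ‖g₁ + p * g₀‖ ≤ ‖g₁‖ + ‖p‖ * ‖g₀‖ := by
    rw [← norm_mul]; exact norm_add_le _ _
  have n2 : ‖g₂ + p * g₁ + p ^ 2 / 2 * g₀‖ ≤ ‖g₂‖ + ‖p‖ * ‖g₁‖ + ‖p‖ ^ 2 / 2 * ‖g₀‖ := by
    refine norm_add₃_le.trans_eq ?_
    rw [norm_mul, norm_mul, norm_div, norm_pow, Complex.norm_ofNat]
  have n3 : ‖B₀ * g₀ + B₁ * (g₁ + p * g₀) + B₂ * (g₂ + p * g₁ + p ^ 2 / 2 * g₀)‖ ≤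
      ‖B₀‖ * ‖g₀‖ + ‖B₁‖ * (‖g₁‖ + ‖p‖ * ‖g₀‖)
        + ‖B₂‖ * (‖g₂‖ + ‖p‖ * ‖g₁‖ + ‖p‖ ^ 2 / 2 * ‖g₀‖) := by
    refine norm_add₃_le.trans ?_
    rw [norm_mul B₀, norm_mul B₁, norm_mul B₂]
    gcongr
  have hps0 : 0 ≤ s * ‖p‖ := by positivity
  set Y := ‖g₀‖ + s * ‖g₁‖ + s ^ 2 * ‖g₂‖ with hY
  have hsg1 : 0 ≤ s * ‖g₁‖ := by positivity
  have hsg2 : 0 ≤ s ^ 2 * ‖g₂‖ := by positivity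
  have m0 : ‖g₀‖ ≤ 2 * Y := by linarith [norm_nonneg g₀]
  have m1 : s * (‖g₁‖ + ‖p‖ * ‖g₀‖) ≤ 2 * Y := by
    have : (s * ‖p‖) * ‖g₀‖ ≤ 2 * ‖g₀‖ := by gcongr
    linarith
  have m2 : s ^ 2 * (‖g₂‖ + ‖p‖ * ‖g₁‖ + ‖p‖ ^ 2 / 2 * ‖g₀‖) ≤ 2 * Y := by
    have e1 : (s * ‖p‖) * (s * ‖g₁‖) ≤ 2 * (s * ‖g₁‖) := by gcongr
    have e2 : (s * ‖p‖) ^ 2 / 2 * ‖g₀‖ ≤ 2 ^ 2 / 2 * ‖g₀‖ := by gcongr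
    linarith
  have hY0 : 0 ≤ Y := by positivity
  have hW : 0 ≤ W := hs.trans hsW
  calc s ^ 2 * ‖B₀ * g₀ + B₁ * (g₁ + p * g₀) + B₂ * (g₂ + p * g₁ + p ^ 2 / 2 * g₀)‖
      ≤ s ^ 2 * (‖B₀‖ * ‖g₀‖ + ‖B₁‖ * (‖g₁‖ + ‖p‖ * ‖g₀‖)
        + ‖B₂‖ * (‖g₂‖ + ‖p‖ * ‖g₁‖ + ‖p‖ ^ 2 / 2 * ‖g₀‖)) := by gcongr
    _ = ‖B₀‖ * s ^ 2 * ‖g₀‖ + ‖B₁‖ * s * (s * (‖g₁‖ + ‖p‖ * ‖g₀‖))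
        + ‖B₂‖ * (s ^ 2 * (‖g₂‖ + ‖p‖ * ‖g₁‖ + ‖p‖ ^ 2 / 2 * ‖g₀‖)) := by ring
    _ ≤ ‖B₀‖ * W ^ 2 * (2 * Y) + ‖B₁‖ * W * (2 * Y) + ‖B₂‖ * (2 * Y) := by gcongr
    _ = _ := by ring

/-- A constant multiple `g₀` of `(f ∘ φ_a) / φ_a'` with its first three derivatives, normalized by
`g₂ 0 = 2`, and the differential inequality that it inherits from the equation for `f`. -/
lemma exists_transported_solution {A : Fin 3 → ℂ → ℂ} {f : ℂ → ℂ} (hf : IsSolution A f) {a : ℂ}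
    (ha : a ∈ twoFoldZeros f) :
    ∃ g₀ g₁ g₂ g₃ : ℂ → ℂ, (∀ z ∈ disk, HasDerivAt g₀ (g₁ z) z) ∧
      (∀ z ∈ disk, HasDerivAt g₁ (g₂ z) z) ∧ (∀ z ∈ disk, HasDerivAt g₂ (g₃ z) z) ∧
      g₀ 0 = 0 ∧ g₁ 0 = 0 ∧ g₂ 0 = 2 ∧ (∀ z ∈ disk, f (diskAut a z) = 0 → g₀ z = 0) ∧
      ∀ z ∈ disk, (1 - ‖z‖) ^ 2 * ‖g₃ z‖ ≤
        2 * density A a z * (‖g₀ z‖ + (1 - ‖z‖) * ‖g₁ z‖ + (1 - ‖z‖) ^ 2 * ‖g₂ z‖) := by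
  obtain ⟨fa0, fa1, fa2⟩ := derivatives_of_mem_twoFoldZeros hf.1 ha
  have had := ha.1
  set b : ℂ := conj a with hb
  set c : ℂ := 1 - conj a * a with hc
  have hc0 : c ≠ 0 := one_sub_conj_mul_self_ne_zero had
  have hq0 : ∀ z ∈ disk, 1 - b * z ≠ 0 := fun z hz => one_sub_conj_mul_ne_zero had hz
  have hφ0 : diskAut a 0 = a := by simp [diskAut]
  set κ : ℂ := 2 / (c ^ 2 * iteratedDeriv 2 f a) with hκ
  have hφ' : ∀ z, diskAutDeriv a z = -c / (1 - b * z) ^ 2 := fun z => rfl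
  have hF : ∀ n, ∀ z ∈ disk, HasDerivAt (fun z => iteratedDeriv n f (diskAut a z))
      (iteratedDeriv (n + 1) f (diskAut a z) * (-c / (1 - b * z) ^ 2)) z := fun n z hz =>
    (hasDerivAt_iteratedDeriv hf.1 n (diskAut_mem_disk had hz)).comp z (hasDerivAt_diskAut had hz)
  have hq : ∀ z, HasDerivAt (fun z => 1 - b * z) (-b) z := fun z => by
    simpa using ((hasDerivAt_id z).const_mul b).const_sub 1
  -- since `φ_a' = -c / (1 - b z) ^ 2`, the first function is a multiple of `(f ∘ φ_a) / φ_a'`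
  refine ⟨fun z => κ * (iteratedDeriv 0 f (diskAut a z) * (1 - b * z) ^ 2),
    fun z => κ * (-c * iteratedDeriv 1 f (diskAut a z)
      - 2 * b * (iteratedDeriv 0 f (diskAut a z) * (1 - b * z))),
    fun z => κ * (c ^ 2 * (iteratedDeriv 2 f (diskAut a z) / (1 - b * z) ^ 2)
      + 2 * b * c * (iteratedDeriv 1 f (diskAut a z) / (1 - b * z))
      + 2 * b ^ 2 * iteratedDeriv 0 f (diskAut a z)),
    fun z => κ * (-c ^ 3 * iteratedDeriv 3 f (diskAut a z) / (1 - b * z) ^ 4),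
    ?_, ?_, ?_, ?_, ?_, ?_, ?_, ?_⟩
  · intro z hz
    have := hq0 z hz
    refine (((hF 0 z hz).fun_mul ((hq z).fun_pow 2)).const_mul κ).congr_deriv ?_
    field_simp
    ring
  · intro z hz
    have := hq0 z hz
    refine ((((hF 1 z hz).const_mul (-c)).fun_sub
      (((hF 0 z hz).fun_mul (hq z)).const_mul (2 * b))).const_mul κ).congr_deriv ?_
    field_simp
    ring
  · intro z hz
    have := hq0 z hz
    refine ((((((hF 2 z hz).fun_div ((hq z).fun_pow 2) (pow_ne_zero 2 this)).const_mul
      (c ^ 2)).fun_add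
      (((hF 1 z hz).fun_div (hq z) this).const_mul (2 * b * c))).fun_add
      ((hF 0 z hz).const_mul (2 * b ^ 2))).const_mul κ).congr_deriv ?_
    field_simp
    ring
  · simp [hφ0, fa0]
  · simp [hφ0, fa0, fa1]
  · simp only [hφ0, fa1, iteratedDeriv_zero, fa0, hκ]
    field_simp
    ring
  · intro z hz h
    simp [h]
  · intro z hz
    have hq := hq0 z hz
    set q := 1 - b * z with hqdef
    have ode := hf.2 _ (diskAut_mem_disk had hz)
    rw [← iteratedDeriv_one, ← iteratedDeriv_zero (f := f)] at ode
    simp only [density, pullbackCoeff, hφ', Fin.sum_univ_three, Fin.val_zero, Fin.val_one,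
      Fin.val_two, ← hqdef]
    rw [iteratedDeriv_zero] at ode
    rw [iteratedDeriv_zero]
    generalize iteratedDeriv 3 f (diskAut a z) = F₃ at *
    generalize iteratedDeriv 2 f (diskAut a z) = F₂ at *
    generalize iteratedDeriv 1 f (diskAut a z) = F₁ at *
    generalize f (diskAut a z) = F₀ at *
    generalize A 0 (diskAut a z) = A₀ at *
    generalize A 1 (diskAut a z) = A₁ at *
    generalize A 2 (diskAut a z) = A₂ at *
    set g₀ : ℂ := κ * (F₀ * q ^ 2) with hg₀
    set g₁ : ℂ := κ * (-c * F₁ - 2 * b * (F₀ * q)) with hg₁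
    set g₂ : ℂ := κ * (c ^ 2 * (F₂ / q ^ 2) + 2 * b * c * (F₁ / q) + 2 * b ^ 2 * F₀) with hg₂
    -- `p = φ_a'' / φ_a'`
    set p : ℂ := 2 * b / q with hp
    set B₀ : ℂ := A₀ * (-c / q ^ 2) ^ (3 - 0)
    set B₁ : ℂ := A₁ * (-c / q ^ 2) ^ (3 - 1)
    set B₂ : ℂ := A₂ * (-c / q ^ 2) ^ (3 - 2)
    have hg₃ : κ * (-c ^ 3 * F₃ / q ^ 4) =
        -(B₀ * g₀ + B₁ * (g₁ + p * g₀) + B₂ * (g₂ + p * g₁ + p ^ 2 / 2 * g₀)) := by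
      have : F₃ = -(A₂ * F₂ + A₁ * F₁ + A₀ * F₀) := by linear_combination ode
      rw [this]
      simp only [hg₀, hg₁, hg₂, hp, B₀, B₁, B₂]
      norm_num
      field_simp
      ring
    have hz1 := mem_disk.1 hz
    have hs : 0 < 1 - ‖z‖ := by linarith
    have hps : (1 - ‖z‖) * ‖p‖ ≤ 2 := by
      have hb1 : ‖b‖ < 1 := by rw [hb, RCLike.norm_conj]; exact mem_disk.1 had
      have h1 : 1 - ‖z‖ ≤ ‖q‖ := by
        have h2 := norm_sub_norm_le (1 : ℂ) (b * z)
        rw [norm_one, norm_mul] at h2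
        nlinarith [norm_nonneg z, norm_nonneg b]
      rw [hp, norm_div, norm_mul, Complex.norm_ofNat, ← mul_div_assoc,
        div_le_iff₀ (norm_pos_iff.2 hq)]
      nlinarith [norm_nonneg b]
    rw [hg₃, norm_neg]
    refine (weighted_norm_le B₀ B₁ B₂ g₀ g₁ g₂ p hs.le
      (by nlinarith [norm_nonneg z] : 1 - ‖z‖ ≤ 1 - ‖z‖ ^ 2) hps).trans_eq ?_
    simp only [Nat.sub_zero, Nat.sub_self, pow_zero, Nat.add_one_sub_one, pow_one, mul_one]

/-- The radial growth estimate for the transported solution. -/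
lemma norm_circle_le_exp {A : Fin 3 → ℂ → ℂ} (hA : ∀ j, DifferentiableOn ℂ (A j) disk) {a : ℂ}
    (ha : a ∈ disk) {g₀ g₁ g₂ g₃ : ℂ → ℂ} (h₀ : ∀ z ∈ disk, HasDerivAt g₀ (g₁ z) z)
    (h₁ : ∀ z ∈ disk, HasDerivAt g₁ (g₂ z) z) (h₂ : ∀ z ∈ disk, HasDerivAt g₂ (g₃ z) z)
    (hg₀ : g₀ 0 = 0) (hg₁ : g₁ 0 = 0) (hg₂ : g₂ 0 = 2)
    (hle : ∀ z ∈ disk, (1 - ‖z‖) ^ 2 * ‖g₃ z‖ ≤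
      2 * density A a z * (‖g₀ z‖ + (1 - ‖z‖) * ‖g₁ z‖ + (1 - ‖z‖) ^ 2 * ‖g₂ z‖))
    {r : ℝ} (hr0 : 0 ≤ r) (hr1 : r < 1) (θ : ℝ) :
    ‖g₀ (circleMap 0 r θ)‖ ≤
      8 * Real.exp (14 * ∫ s in (0 : ℝ)..r, density A a (circleMap 0 s θ)) := by
  set e : ℂ := Complex.exp (θ * Complex.I) with he
  have hen : ‖e‖ = 1 := Complex.norm_exp_ofReal_mul_I θ
  have hcm : ∀ t : ℝ, circleMap 0 t θ = t * e := fun t => by simp [circleMap, he]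
  have hnorm : ∀ t ∈ Icc 0 r, ‖circleMap 0 t θ‖ = t := fun t ht => by
    simp [abs_of_nonneg ht.1]
  have hmem : ∀ t ∈ Icc 0 r, circleMap 0 t θ ∈ disk := fun t ht => by
    rw [mem_disk, hnorm t ht]; exact ht.2.trans_lt hr1
  have hγ : ∀ t : ℝ, HasDerivAt (fun t : ℝ => circleMap 0 t θ) e t := by
    intro t
    simp only [hcm]
    simpa using (Complex.ofRealCLM.hasDerivAt (x := t)).mul_const e
  have hγc : Continuous fun t : ℝ => circleMap 0 t θ :=
    continuous_iff_continuousAt.2 fun t => (hγ t).continuousAt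
  have hd : ∀ (n : ℕ) (G G' : ℂ → ℂ), (∀ z ∈ disk, HasDerivAt G (G' z) z) → ∀ t ∈ Icc 0 r,
      HasDerivAt (fun t : ℝ => e ^ n * G (circleMap 0 t θ))
        (e ^ (n + 1) * G' (circleMap 0 t θ)) t := by
    intro n G G' hG t ht
    have := ((hG _ (hmem t ht)).comp t (hγ t)).const_mul (e ^ n)
    refine this.congr_deriv ?_
    ring
  have hg₃c : ContinuousOn g₃ disk := by
    have hdiff : DifferentiableOn ℂ g₂ disk :=
      fun z hz => (h₂ z hz).differentiableAt.differentiableWithinAt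
    exact (hdiff.deriv Metric.isOpen_ball).continuousOn.congr fun z hz => (h₂ z hz).deriv.symm
  have hnn : ∀ (n : ℕ) (z : ℂ), ‖e ^ n * z‖ = ‖z‖ := fun n z => by
    rw [norm_mul, norm_pow, hen, one_pow, one_mul]
  have h0 : circleMap 0 0 θ = 0 := by simp
  have key := norm_le_exp_of_third_order (κ := fun t => 2 * density A a (circleMap 0 t θ)) hr0 hr1
    (continuousOn_const.mul ((continuousOn_density hA ha).comp hγc.continuousOn hmem))
    (fun t ht => mul_nonneg zero_le_two (density_nonneg A a (hmem t ht)))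
    (hd 0 g₀ g₁ h₀) (hd 1 g₁ g₂ h₁) (hd 2 g₂ g₃ h₂)
    (continuousOn_const.mul (hg₃c.comp hγc.continuousOn hmem)) (by simp [hg₀]) (by simp [hg₁])
    (fun t ht => by
      have := hle _ (hmem t ht)
      rw [hnorm t ht] at this
      simpa only [hnn] using this)
  rw [hnn, hnn, h0, hg₂, Complex.norm_ofNat, intervalIntegral.integral_const_mul,
    ← mul_assoc] at key
  norm_num at key ⊢
  exact key

/-! ### Jensen's formula -/

/-- Jensen's formula, with all but finitely many zeros discarded. -/
lemma sum_log_le_circleAverage {h : ℂ → ℂ} {r : ℝ} (hr : 0 < r)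
    (hh : AnalyticOnNhd ℂ h (Metric.closedBall 0 r)) (h0 : h 0 = 1) (S : Finset ℂ)
    (hS : ∀ u ∈ S, ‖u‖ ≤ r ∧ h u = 0) :
    ∑ u ∈ S, Real.log (r * ‖u‖⁻¹) ≤ Real.circleAverage (Real.log ‖h ·‖) 0 r := by
  rw [← abs_of_pos hr] at hh
  have hJ := hh.circleAverage_log_norm hr.ne' (by rw [h0]; exact one_ne_zero)
  rw [hJ, h0, norm_one, Real.log_one, add_zero]
  set D := MeromorphicOn.divisor h (Metric.closedBall 0 |r|) with hD
  have hfin := D.finiteSupport (isCompact_closedBall 0 |r|)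
  have hDnn : ∀ u, 0 ≤ D u := fun u => (MeromorphicOn.AnalyticOnNhd.divisor_nonneg hh : 0 ≤ D) u
  have hlog : ∀ u, D u ≠ 0 → 0 ≤ Real.log (r * ‖0 - u‖⁻¹) := by
    intro u hu
    have : u ∈ Metric.closedBall (0 : ℂ) |r| := D.supportWithinDomain hu
    rw [mem_closedBall_zero_iff, abs_of_pos hr] at this
    rw [zero_sub, norm_neg]
    rcases eq_or_ne u 0 with rfl | h
    · simp
    · apply Real.log_nonneg
      rw [← div_eq_mul_inv, one_le_div (norm_pos_iff.2 h)]
      exact this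
  have hDS : ∀ u ∈ S, 1 ≤ D u := by
    intro u hu
    obtain ⟨hur, huz⟩ := hS u hu
    have hmem : u ∈ Metric.closedBall (0 : ℂ) |r| := by
      rwa [mem_closedBall_zero_iff, abs_of_pos hr]
    have hne0 : analyticOrderAt h u ≠ 0 := by
      rw [Ne, (hh u hmem).analyticOrderAt_eq_zero]
      simpa using huz
    have hnt : analyticOrderAt h u ≠ ⊤ := by
      refine hh.analyticOrderAt_ne_top_of_isPreconnected (x := 0)
        (convex_closedBall _ _).isPreconnected (by simp) hmem ?_
      rw [(hh 0 (by simp)).analyticOrderAt_eq_zero.2 (by rw [h0]; exact one_ne_zero)]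
      simp
    rw [hD, MeromorphicOn.AnalyticOnNhd.divisor_apply hh hmem]
    lift analyticOrderAt h u to ℕ using hnt with n
    rw [ENat.map_natCast, WithTop.untop₀_coe]
    have : n ≠ 0 := by rintro rfl; exact hne0 rfl
    omega
  classical
  rw [finsum_eq_sum_of_support_subset (s := hfin.toFinset ∪ S)]
  · calc ∑ u ∈ S, Real.log (r * ‖u‖⁻¹)
        ≤ ∑ u ∈ S, (D u : ℝ) * Real.log (r * ‖0 - u‖⁻¹) := by
          refine Finset.sum_le_sum fun u hu => ?_
          have h1 : (1 : ℝ) ≤ D u := by exact_mod_cast hDS u hu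
          have h2 := hlog u (by have := hDS u hu; omega)
          rw [zero_sub, norm_neg] at h2 ⊢
          nlinarith
      _ ≤ _ := by
          refine Finset.sum_le_sum_of_subset_of_nonneg Finset.subset_union_right fun u _ _ => ?_
          by_cases hu : D u = 0
          · simp [hu]
          · exact mul_nonneg (by exact_mod_cast hDnn u) (hlog u hu)
  · intro u hu
    rw [Finset.coe_union, Finite.coe_toFinset]
    left
    intro h
    simp [h] at hu

/-- If the circle means of `log ‖h‖` are at most `C` and `h 0 = 1`, then the moduli of finitely many
zeros of `h` have product at least `exp (-C)`: Jensen's formula as the radius tends to `1`. -/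
lemma exp_neg_le_prod_norm {h : ℂ → ℂ} (hh : DifferentiableOn ℂ h disk) (h0 : h 0 = 1) {C : ℝ}
    (hC : ∀ r ∈ Ico (1 / 2 : ℝ) 1, Real.circleAverage (Real.log ‖h ·‖) 0 r ≤ C) (S : Finset ℂ)
    (hS : ∀ u ∈ S, u ∈ disk ∧ h u = 0) : Real.exp (-C) ≤ ∏ u ∈ S, ‖u‖ := by
  have hpos : ∀ u ∈ S, 0 < ‖u‖ := by
    intro u hu
    rw [norm_pos_iff]
    rintro rfl
    rw [(hS _ hu).2] at h0
    exact zero_ne_one h0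
  have hev : ∀ᶠ r in 𝓝[<] (1 : ℝ), ∑ u ∈ S, Real.log (r * ‖u‖⁻¹) ≤ C := by
    have h1 : ∀ᶠ r in 𝓝[<] (1 : ℝ), ∀ u ∈ S, ‖u‖ < r := by
      rw [Filter.eventually_all_finset]
      intro u hu
      exact eventually_nhdsWithin_of_eventually_nhds (lt_mem_nhds (mem_disk.1 (hS u hu).1))
    have h2 : ∀ᶠ r in 𝓝[<] (1 : ℝ), r ∈ Ico (1 / 2 : ℝ) 1 := Ico_mem_nhdsLT (by norm_num)
    filter_upwards [h1, h2] with r hr1 hr2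
    refine (sum_log_le_circleAverage (by linarith [hr2.1]) ?_ h0 S
      fun u hu => ⟨(hr1 u hu).le, (hS u hu).2⟩).trans (hC r hr2)
    exact (hh.analyticOnNhd Metric.isOpen_ball).mono (Metric.closedBall_subset_ball hr2.2)
  have hlim : Tendsto (fun r : ℝ => ∑ u ∈ S, Real.log (r * ‖u‖⁻¹)) (𝓝[<] 1)
      (𝓝 (∑ u ∈ S, Real.log (1 * ‖u‖⁻¹))) := by
    refine tendsto_nhdsWithin_of_tendsto_nhds (tendsto_finsetSum _ fun u hu => ?_)
    have := hpos u hu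
    refine ((continuous_id.mul continuous_const).tendsto (1 : ℝ)).log ?_
    simp [this.ne']
  have := le_of_tendsto hlim hev
  simp only [one_mul, Real.log_inv, Finset.sum_neg_distrib] at this
  rw [← Real.log_prod (fun u hu => (hpos u hu).ne')] at this
  rw [← Real.le_log_iff_exp_le (Finset.prod_pos hpos)]
  linarith

/-! ### Consequences of the Carleson conditions -/

/-- An infinite product of factors in `[0, 1]` converges to the infimum of its finite products. -/
lemma le_tprod_of_le_finset_prod {ι : Type*} {p : ι → ℝ} {δ : ℝ} (h0 : ∀ i, 0 ≤ p i)
    (h1 : ∀ i, p i ≤ 1) (hδ : ∀ S : Finset ι, δ ≤ ∏ i ∈ S, p i) : δ ≤ ∏' i, p i := by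
  have hanti : Antitone fun S : Finset ι => ∏ i ∈ S, p i := fun S T hST => by
    classical
    beta_reduce
    rw [← Finset.prod_sdiff hST]
    exact mul_le_of_le_one_left (Finset.prod_nonneg fun i _ => h0 i)
      (Finset.prod_le_one (fun i _ => h0 i) fun i _ => h1 i)
  have hp : HasProd p (⨅ S : Finset ι, ∏ i ∈ S, p i) :=
    tendsto_atTop_ciInf hanti ⟨δ, by rintro _ ⟨S, rfl⟩; exact hδ S⟩
  rw [hp.tprod_eq]
  exact le_ciInf hδ

/-- A double zero at the origin is divided out of an analytic function on the disc. -/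
lemma exists_factor_sq {g g₁ g₂ : ℂ → ℂ} (h₀ : ∀ z ∈ disk, HasDerivAt g (g₁ z) z)
    (h₁ : ∀ z ∈ disk, HasDerivAt g₁ (g₂ z) z) (hg : g 0 = 0) (hg₁ : g₁ 0 = 0) :
    ∃ h : ℂ → ℂ, DifferentiableOn ℂ h disk ∧ (∀ z, g z = z ^ 2 * h z) ∧ h 0 = g₂ 0 / 2 := by
  have h0d : (0 : ℂ) ∈ disk := by simp [mem_disk]
  have hnhds : disk ∈ 𝓝 (0 : ℂ) := Metric.isOpen_ball.mem_nhds h0d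
  have hgd : DifferentiableOn ℂ g disk := fun z hz =>
    (h₀ z hz).differentiableAt.differentiableWithinAt
  set d := dslope g 0 with hd
  have hdd : DifferentiableOn ℂ d disk := (Complex.differentiableOn_dslope hnhds).2 hgd
  have hgd' : ∀ z, g z = z * d z := fun z => by
    have := sub_smul_dslope g 0 z
    rw [sub_zero, hg, sub_zero, smul_eq_mul] at this
    exact this.symm
  have hd0 : d 0 = 0 := by rw [hd, dslope_same, (h₀ 0 h0d).deriv, hg₁]
  refine ⟨dslope d 0, (Complex.differentiableOn_dslope hnhds).2 hdd, fun z => ?_, ?_⟩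
  · have := sub_smul_dslope d 0 z
    rw [sub_zero, hd0, sub_zero, smul_eq_mul] at this
    rw [hgd', ← this]
    ring
  · have hder : ∀ z ∈ disk, HasDerivAt d (deriv d z) z := fun z hz =>
      ((hdd z hz).differentiableAt (Metric.isOpen_ball.mem_nhds hz)).hasDerivAt
    have hg₁e : g₁ =ᶠ[𝓝 0] fun z => d z + z * deriv d z := by
      filter_upwards [hnhds] with z hz
      have e : g = fun z => z * d z := funext hgd'
      have h2 := (hasDerivAt_id z).fun_mul (hder z hz)
      have h3 := h₀ z hz
      rw [e] at h3
      simpa using h3.unique h2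
    have hdd2 : HasDerivAt (deriv d) (deriv (deriv d) 0) 0 :=
      (((hdd.deriv Metric.isOpen_ball) 0 h0d).differentiableAt hnhds).hasDerivAt
    have h4 := ((hder 0 h0d).fun_add ((hasDerivAt_id (0 : ℂ)).fun_mul hdd2)).congr_of_eventuallyEq
      hg₁e
    have h5 := (h₁ 0 h0d).unique h4
    rw [dslope_same, h5]
    simp

/-- The Carleson conditions, rewritten as a uniform bound for the integrals of the densities. -/
lemma exists_lintegral_density_le {A : Fin 3 → ℂ → ℂ} (hA : ∀ j, DifferentiableOn ℂ (A j) disk)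
    (h : ∀ j : Fin 3, (⨆ a ∈ disk, ∫⁻ z, ENNReal.ofReal
      (‖A j z‖ * (1 - ‖z‖ ^ 2) ^ (1 - ((j : ℕ) : ℤ)) * (1 - ‖diskAut a z‖ ^ 2))
      ∂areaMeasure) < ⊤) :
    ∃ M : ℝ, 0 ≤ M ∧ ∀ a ∈ disk,
      ∫⁻ z in disk, ENNReal.ofReal (density A a z) ≤ ENNReal.ofReal M := by
  have hV0 : volume disk ≠ 0 := (Metric.measure_ball_pos volume (0 : ℂ) one_pos).ne'
  have hVt : volume disk ≠ ⊤ := measure_ball_lt_top.ne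
  set m : Fin 3 → ENNReal := fun j => ⨆ a ∈ disk, ∫⁻ z, ENNReal.ofReal
      (‖A j z‖ * (1 - ‖z‖ ^ 2) ^ (1 - ((j : ℕ) : ℤ)) * (1 - ‖diskAut a z‖ ^ 2)) ∂areaMeasure with hm
  have hfin : volume disk * ∑ j, m j ≠ ⊤ :=
    ENNReal.mul_ne_top hVt (ENNReal.sum_ne_top.2 fun j _ => (h j).ne)
  refine ⟨(volume disk * ∑ j, m j).toReal, ENNReal.toReal_nonneg, fun a ha => ?_⟩
  rw [ENNReal.ofReal_toReal hfin]
  have hmeas : ∀ j : Fin 3, AEMeasurable (fun z => ENNReal.ofReal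
      (‖pullbackCoeff A a j z‖ * (1 - ‖z‖ ^ 2) ^ (2 - (j : ℕ)))) (volume.restrict disk) := fun j =>
    (ContinuousOn.aemeasurable
      ((differentiableOn_pullbackCoeff hA ha j).continuousOn.norm.mul (by fun_prop))
      measurableSet_disk).ennreal_ofReal
  calc ∫⁻ z in disk, ENNReal.ofReal (density A a z)
      = ∫⁻ z in disk, ∑ j : Fin 3, ENNReal.ofReal
          (‖pullbackCoeff A a j z‖ * (1 - ‖z‖ ^ 2) ^ (2 - (j : ℕ))) :=
        setLIntegral_congr_fun measurableSet_disk fun z hz =>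
          ENNReal.ofReal_sum_of_nonneg fun j _ =>
            mul_nonneg (norm_nonneg _) (pow_nonneg (one_sub_normSq_pos hz).le _)
    _ = ∑ j : Fin 3, ∫⁻ z in disk, ENNReal.ofReal
          (‖pullbackCoeff A a j z‖ * (1 - ‖z‖ ^ 2) ^ (2 - (j : ℕ))) :=
        lintegral_finsetSum' _ fun j _ => hmeas j
    _ ≤ ∑ j : Fin 3, volume disk * m j := by
        refine Finset.sum_le_sum fun j _ => ?_
        have h1 := le_iSup₂ (f := fun a (_ : a ∈ disk) => ∫⁻ z, ENNReal.ofReal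
          (‖A j z‖ * (1 - ‖z‖ ^ 2) ^ (1 - ((j : ℕ) : ℤ)) * (1 - ‖diskAut a z‖ ^ 2))
          ∂areaMeasure) a ha
        rw [← lintegral_pullbackCoeff A ha j]
        refine le_trans ?_ (mul_le_mul_right h1 (volume disk))
        rw [areaMeasure, lintegral_smul_measure, smul_eq_mul, ← mul_assoc,
          ENNReal.mul_inv_cancel hV0 hVt, one_mul]
    _ = _ := (Finset.mul_sum _ _ _).symm

lemma norm_pullbackCoeff_mul {A : Fin 3 → ℂ → ℂ} {a z : ℂ} (ha : a ∈ disk) (hz : z ∈ disk)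
    (j : Fin 3) : ‖pullbackCoeff A a j z‖ * (1 - ‖z‖ ^ 2) ^ (3 - (j : ℕ))
      = ‖A j (diskAut a z)‖ * (1 - ‖diskAut a z‖ ^ 2) ^ (3 - (j : ℕ)) := by
  rw [← norm_diskAutDeriv_mul ha hz, pullbackCoeff, norm_mul, norm_pow, mul_pow, mul_assoc]

/-- The Carleson conditions imply the growth conditions of part (i), by the mean value property for
the transported coefficient at the origin. -/
lemma norm_coeff_le {A : Fin 3 → ℂ → ℂ} (hA : ∀ j, DifferentiableOn ℂ (A j) disk) {M : ℝ}
    (hM0 : 0 ≤ M)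
    (hM : ∀ a ∈ disk, ∫⁻ z in disk, ENNReal.ofReal (density A a z) ≤ ENNReal.ofReal M) (j : Fin 3)
    {a : ℂ} (ha : a ∈ disk) : ‖A j a‖ * (1 - ‖a‖ ^ 2) ^ (3 - (j : ℕ)) ≤ 32 * M := by
  have h0d : (0 : ℂ) ∈ disk := by simp [mem_disk]
  have h1 := norm_pullbackCoeff_mul (A := A) ha h0d j
  have hφ0 : diskAut a 0 = a := by simp [diskAut]
  rw [norm_zero, hφ0] at h1
  norm_num at h1
  rw [← h1]
  have h2 := norm_zero_le_lintegral (differentiableOn_pullbackCoeff hA ha j)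
  have hsub : Metric.ball (0 : ℂ) (1 / 2) ⊆ disk := Metric.ball_subset_ball (by norm_num)
  have h3 : ∀ z ∈ Metric.ball (0 : ℂ) (1 / 2), ‖pullbackCoeff A a j z‖ ≤ 2 * density A a z := by
    intro z hz
    have hzd := hsub hz
    rw [mem_ball_zero_iff] at hz
    have hw : 3 / 4 ≤ 1 - ‖z‖ ^ 2 := by nlinarith [norm_nonneg z]
    have hw1 : 1 - ‖z‖ ^ 2 ≤ 1 := by nlinarith [norm_nonneg z]
    have h4 : ‖pullbackCoeff A a j z‖ * (1 - ‖z‖ ^ 2) ^ (2 - (j : ℕ)) ≤ density A a z :=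
      Finset.single_le_sum (f := fun j : Fin 3 => ‖pullbackCoeff A a j z‖ *
        (1 - ‖z‖ ^ 2) ^ (2 - (j : ℕ))) (fun i _ => mul_nonneg (norm_nonneg _)
          (pow_nonneg (by linarith) _)) (Finset.mem_univ j)
    have h5 : 1 / 2 ≤ (1 - ‖z‖ ^ 2) ^ (2 - (j : ℕ)) := by
      have : (1 - ‖z‖ ^ 2) ^ 2 ≤ (1 - ‖z‖ ^ 2) ^ (2 - (j : ℕ)) :=
        pow_le_pow_of_le_one (by linarith) hw1 (by omega)
      nlinarith
    nlinarith [norm_nonneg (pullbackCoeff A a j z)]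
  have h4 : ENNReal.ofReal ‖pullbackCoeff A a j 0‖ ≤ ENNReal.ofReal (32 * M) := by
    calc _ ≤ 16 * ∫⁻ z in Metric.ball 0 (1 / 2), ENNReal.ofReal ‖pullbackCoeff A a j z‖ := h2
      _ ≤ 16 * ∫⁻ z in disk, 2 * ENNReal.ofReal (density A a z) := by
          gcongr 16 * ?_
          refine (setLIntegral_mono' measurableSet_ball fun z hz => ?_).trans
            (lintegral_mono_set hsub)
          rw [← ENNReal.ofReal_ofNat, ← ENNReal.ofReal_mul (by norm_num)]
          exact ENNReal.ofReal_le_ofReal (h3 z hz)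
      _ ≤ 16 * (2 * ENNReal.ofReal M) := by
          rw [lintegral_const_mul' _ _ (by norm_num)]
          gcongr
          exact hM a ha
      _ = ENNReal.ofReal (32 * M) := by
          rw [ENNReal.ofReal_mul (by norm_num), ← mul_assoc]
          norm_num
  exact (ENNReal.ofReal_le_ofReal_iff (by positivity)).1 h4

/-- The growth conditions are invariant under `diskAut a`, so the density is bounded near the
origin, uniformly in `a`. -/
lemma density_le_of_norm_le_half {A : Fin 3 → ℂ → ℂ} {N : ℝ}
    (hN : ∀ j : Fin 3, ∀ a ∈ disk, ‖A j a‖ * (1 - ‖a‖ ^ 2) ^ (3 - (j : ℕ)) ≤ N) {a z : ℂ}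
    (ha : a ∈ disk) (hz : ‖z‖ ≤ 1 / 2) : density A a z ≤ 6 * N := by
  have hzd : z ∈ disk := by rw [mem_disk]; linarith
  have hw : 3 / 4 ≤ 1 - ‖z‖ ^ 2 := by nlinarith [norm_nonneg z]
  have hj : ∀ j : Fin 3, ‖pullbackCoeff A a j z‖ * (1 - ‖z‖ ^ 2) ^ (2 - (j : ℕ)) ≤ 2 * N := by
    intro j
    have h1 := hN j _ (diskAut_mem_disk ha hzd)
    rw [← norm_pullbackCoeff_mul ha hzd j, show 3 - (j : ℕ) = (2 - (j : ℕ)) + 1 by omega, pow_succ,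
      ← mul_assoc] at h1
    have : 0 ≤ ‖pullbackCoeff A a j z‖ * (1 - ‖z‖ ^ 2) ^ (2 - (j : ℕ)) :=
      mul_nonneg (norm_nonneg _) (pow_nonneg (by linarith) _)
    nlinarith
  calc density A a z ≤ ∑ _j : Fin 3, 2 * N := Finset.sum_le_sum fun j _ => hj j
    _ = 6 * N := by simp; ring

/-! ### Uniform separation -/

/-- Averaging the radial growth estimate over the circle of radius `r`. The radial integral is
compared with the area integral through `density ≤ N + 2 * s * density` on the circle of radius `s`,
which holds for `s ≤ 1 / 2` by the bound `N` and for `s ≥ 1 / 2` trivially. -/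
lemma circleAverage_le_of_growth {A : Fin 3 → ℂ → ℂ} (hA : ∀ j, DifferentiableOn ℂ (A j) disk)
    {a : ℂ} (ha : a ∈ disk) {M N : ℝ} (hM0 : 0 ≤ M)
    (hM : ∫⁻ z in disk, ENNReal.ofReal (density A a z) ≤ ENNReal.ofReal M)
    (hN : ∀ z, ‖z‖ ≤ 1 / 2 → density A a z ≤ N) {h : ℂ → ℂ} (hh : DifferentiableOn ℂ h disk)
    {r : ℝ} (hr : r ∈ Ico (1 / 2 : ℝ) 1)
    (hle : ∀ θ : ℝ, ‖h (circleMap 0 r θ)‖ ≤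
      32 * Real.exp (14 * ∫ s in (0 : ℝ)..r, density A a (circleMap 0 s θ))) :
    Real.circleAverage (Real.log ‖h ·‖) 0 r ≤ Real.log 32 + 14 * (N + M) := by
  have hr0 : 0 < r := by linarith [hr.1]
  have hnorm : ∀ s ∈ Icc 0 r, ∀ θ, ‖circleMap 0 s θ‖ = s := fun s hs θ => by
    simp [abs_of_nonneg hs.1]
  have hmem : ∀ s ∈ Icc 0 r, ∀ θ, circleMap 0 s θ ∈ disk := fun s hs θ => by
    rw [mem_disk, hnorm s hs θ]; exact hs.2.trans_lt hr.2
  have hdc := continuousOn_density hA ha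
  have hN0 : 0 ≤ N := (density_nonneg A a (by simp [mem_disk])).trans (hN 0 (by simp))
  have hcs : ∀ θ, Continuous fun s : ℝ => circleMap 0 s θ := fun θ => by
    unfold circleMap; fun_prop
  have hdcs : ∀ θ, ContinuousOn (fun s => density A a (circleMap 0 s θ)) (Icc 0 r) := fun θ =>
    hdc.comp (hcs θ).continuousOn fun s hs => hmem s hs θ
  set J : ℝ → ℝ := fun θ => ∫ s in (0 : ℝ)..r, s * density A a (circleMap 0 s θ) with hJ
  have hsdi : ∀ θ, ContinuousOn (fun s => s * density A a (circleMap 0 s θ)) (Icc 0 r) := fun θ =>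
    continuousOn_id.mul (hdcs θ)
  have hJint : ∀ θ, (∫ s in (0 : ℝ)..r, density A a (circleMap 0 s θ)) ≤ N + 2 * J θ := by
    intro θ
    have h1 : (∫ s in (0 : ℝ)..r, density A a (circleMap 0 s θ)) ≤
        ∫ s in (0 : ℝ)..r, (N + 2 * (s * density A a (circleMap 0 s θ))) := by
      apply intervalIntegral.integral_mono_on hr0.le
      · exact ContinuousOn.intervalIntegrable (by rw [uIcc_of_le hr0.le]; exact hdcs θ)
      · exact ContinuousOn.intervalIntegrable (by
          rw [uIcc_of_le hr0.le]; exact continuousOn_const.add (continuousOn_const.mul (hsdi θ)))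
      · intro s hs
        have hd0 := density_nonneg A a (hmem s hs θ)
        rcases le_total s (1 / 2) with h | h
        · have := hN _ ((hnorm s hs θ).le.trans h)
          have : 0 ≤ s * density A a (circleMap 0 s θ) := mul_nonneg hs.1 hd0
          linarith
        · nlinarith
    rw [intervalIntegral.integral_add (by simp), intervalIntegral.integral_const_mul,
      intervalIntegral.integral_const, smul_eq_mul] at h1
    · refine h1.trans ?_
      have : (r - 0) * N ≤ N := by nlinarith [hr.2]
      linarith
    · exact ContinuousOn.intervalIntegrable (by
        rw [uIcc_of_le hr0.le]; exact continuousOn_const.mul (hsdi θ))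
  have hJ0 : ∀ θ, 0 ≤ J θ := fun θ => intervalIntegral.integral_nonneg hr0.le fun s hs =>
    mul_nonneg hs.1 (density_nonneg A a (hmem s hs θ))
  -- clamping the radius makes the integrand globally continuous
  have hJc : Continuous J := by
    set cl : ℝ → ℝ := fun s => max 0 (min s r) with hcl
    have hclm : ∀ s, cl s ∈ Icc 0 r := fun s => ⟨le_max_left _ _, max_le hr0.le (min_le_right _ _)⟩
    have e : J = fun θ => ∫ s in (0 : ℝ)..r, s * density A a (circleMap 0 (cl s) θ) := by
      funext θ
      apply intervalIntegral.integral_congr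
      intro s hs
      rw [uIcc_of_le hr0.le] at hs
      simp [hcl, min_eq_left hs.2, max_eq_right hs.1]
    rw [e]
    apply intervalIntegral.continuous_parametric_intervalIntegral_of_continuous'
    refine continuous_snd.mul (hdc.comp_continuous ?_ fun p => hmem _ (hclm _) _)
    simp only [circleMap, hcl]
    fun_prop
  have hJper : Function.Periodic (fun θ => Real.log 32 + 14 * (N + 2 * J θ)) (2 * π) := fun θ => by
    simp only [hJ, (periodic_circleMap 0 _) θ]
  have hJM : ∫ θ in (-π)..π, J θ ≤ M := by
    rw [← ENNReal.ofReal_le_ofReal_iff hM0]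
    refine le_trans ?_ hM
    have hmeas : Measurable (disk.indicator fun z => ENNReal.ofReal (density A a z)) :=
      measurable_indicator_of_continuousOn measurableSet_disk
        (ENNReal.continuous_ofReal.comp_continuousOn hdc)
    rw [← lintegral_indicator measurableSet_disk, ← lintegral_polar hmeas,
      intervalIntegral.integral_of_le (by linarith [Real.pi_pos]),
      restrict_Ioo_eq_restrict_Ioc, ofReal_integral_eq_lintegral_ofReal
        (hJc.integrableOn_Ioc) (ae_of_all _ hJ0)]
    refine lintegral_mono fun θ => ?_
    simp only [hJ]
    rw [intervalIntegral.integral_of_le hr0.le, ofReal_integral_eq_lintegral_ofReal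
      ((hsdi θ).integrableOn_Icc.mono_set Ioc_subset_Icc_self)]
    · refine (setLIntegral_mono' measurableSet_Ioc fun s hs => ?_).trans
        (lintegral_mono_set Ioc_subset_Ioi_self)
      rw [indicator_of_mem (hmem s (Ioc_subset_Icc_self hs) θ), ENNReal.ofReal_mul hs.1.le]
    · filter_upwards [ae_restrict_mem measurableSet_Ioc] with s hs
      exact mul_nonneg hs.1.le (density_nonneg A a (hmem s (Ioc_subset_Icc_self hs) θ))
  have hpt : ∀ θ, Real.log ‖h (circleMap 0 r θ)‖ ≤ Real.log 32 + 14 * (N + 2 * J θ) := by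
    intro θ
    have h1 := hle θ
    have h2 := hJint θ
    rcases (norm_nonneg (h (circleMap 0 r θ))).eq_or_lt with h3 | h3
    · rw [← h3, Real.log_zero]
      have := hJ0 θ
      have := Real.log_nonneg (show (1 : ℝ) ≤ 32 by norm_num)
      positivity
    · have h4 := Real.log_le_log h3 h1
      rw [Real.log_mul (by norm_num) (Real.exp_pos _).ne', Real.log_exp] at h4
      linarith
  have hci : CircleIntegrable (Real.log ‖h ·‖) 0 r := by
    apply MeromorphicOn.circleIntegrable_log_norm
    intro z hz
    refine (hh.analyticOnNhd Metric.isOpen_ball z ?_).meromorphicAt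
    rw [mem_sphere_zero_iff_norm, abs_of_pos hr0] at hz
    rw [mem_disk, hz]
    exact hr.2
  have hmain : ∫ θ in (0 : ℝ)..2 * π, Real.log ‖h (circleMap 0 r θ)‖ ≤
      2 * π * (Real.log 32 + 14 * N) + 28 * M := by
    calc ∫ θ in (0 : ℝ)..2 * π, Real.log ‖h (circleMap 0 r θ)‖
        ≤ ∫ θ in (0 : ℝ)..2 * π, (Real.log 32 + 14 * (N + 2 * J θ)) := by
          apply intervalIntegral.integral_mono_on (by positivity) hci
          · exact Continuous.intervalIntegrable (by fun_prop) _ _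
          · exact fun θ _ => hpt θ
      _ = ∫ θ in (-π)..π, (Real.log 32 + 14 * (N + 2 * J θ)) := by
          have := hJper.intervalIntegral_add_eq 0 (-π)
          rwa [zero_add, show -π + 2 * π = π by ring] at this
      _ = ∫ θ in (-π)..π, ((Real.log 32 + 14 * N) + 28 * J θ) := by
          congr 1; funext θ; ring
      _ = 2 * π * (Real.log 32 + 14 * N) + 28 * ∫ θ in (-π)..π, J θ := by
          rw [intervalIntegral.integral_add (by simp)
            (Continuous.intervalIntegrable (by fun_prop) _ _), intervalIntegral.integral_const_mul,
            intervalIntegral.integral_const, smul_eq_mul]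
          ring
      _ ≤ _ := by gcongr
  rw [Real.circleAverage, smul_eq_mul, inv_mul_le_iff₀ (by positivity)]
  refine hmain.trans ?_
  nlinarith [Real.pi_gt_three]

/-- Finite products of pseudo-hyperbolic distances from a two-fold zero `a` to other zeros, of any
multiplicity, are bounded below by a constant that does not depend on `a`. -/
lemma exp_neg_le_prod_pseudoDist {A : Fin 3 → ℂ → ℂ} (hA : ∀ j, DifferentiableOn ℂ (A j) disk)
    {f : ℂ → ℂ} (hf : IsSolution A f) {M N : ℝ} (hM0 : 0 ≤ M) {a : ℂ} (ha : a ∈ twoFoldZeros f)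
    (hM : ∫⁻ z in disk, ENNReal.ofReal (density A a z) ≤ ENNReal.ofReal M)
    (hN : ∀ z, ‖z‖ ≤ 1 / 2 → density A a z ≤ N) (S : Finset ℂ)
    (hS : ∀ w ∈ S, w ∈ disk ∧ w ≠ a ∧ f w = 0) :
    Real.exp (-(Real.log 32 + 14 * (N + M))) ≤ ∏ w ∈ S, pseudoDist w a := by
  obtain ⟨g₀, g₁, g₂, g₃, h₀, h₁, h₂, hg₀, hg₁, hg₂, hz, hle⟩ := exists_transported_solution hf ha
  obtain ⟨h, hh, hgh, hh0⟩ := exists_factor_sq h₀ h₁ hg₀ hg₁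
  have had := ha.1
  classical
  have hinj : InjOn (diskAut a) S := (injOn_diskAut had).mono fun w hw => (hS w hw).1
  have key := exp_neg_le_prod_norm hh (by rw [hh0, hg₂]; norm_num)
    (C := Real.log 32 + 14 * (N + M)) (fun r hr => ?_) (S.image (diskAut a)) ?_
  · rw [Finset.prod_image hinj] at key
    simpa only [pseudoDist_eq_norm_diskAut] using key
  · refine circleAverage_le_of_growth hA had hM0 hM hN hh hr fun θ => ?_
    have hr0 : 0 < r := by linarith [hr.1]
    have hgr := norm_circle_le_exp hA had h₀ h₁ h₂ hg₀ hg₁ hg₂ hle hr0.le hr.2 θ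
    rw [hgh, norm_mul, norm_pow, norm_circleMap_zero, abs_of_pos hr0] at hgr
    -- dividing by `r ^ 2` costs at most a factor `4`, which turns `8` into `32`
    have : 1 / 4 ≤ r ^ 2 := by nlinarith [hr.1]
    nlinarith [norm_nonneg (h (circleMap 0 r θ))]
  · intro u hu
    obtain ⟨w, hw, rfl⟩ := Finset.mem_image.1 hu
    obtain ⟨hwd, hwa, hwf⟩ := hS w hw
    refine ⟨diskAut_mem_disk had hwd, ?_⟩
    have h0 := hz _ (diskAut_mem_disk had hwd) (by rw [diskAut_diskAut had hwd, hwf])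
    rw [hgh] at h0
    refine (mul_eq_zero.1 h0).resolve_left (pow_ne_zero 2 ?_)
    rw [diskAut]
    exact div_ne_zero (sub_ne_zero.2 hwa.symm) (one_sub_conj_mul_ne_zero had hwd)

theorem isUniformlySeparated_twoFoldZeros {A : Fin 3 → ℂ → ℂ}
    (hA : ∀ j, DifferentiableOn ℂ (A j) disk) {f : ℂ → ℂ} (hf : IsSolution A f)
    (h : ∀ j : Fin 3, (⨆ a ∈ disk, ∫⁻ z, ENNReal.ofReal
      (‖A j z‖ * (1 - ‖z‖ ^ 2) ^ (1 - ((j : ℕ) : ℤ)) * (1 - ‖diskAut a z‖ ^ 2))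
      ∂areaMeasure) < ⊤) :
    IsUniformlySeparated (twoFoldZeros f) := by
  obtain ⟨M, hM0, hM⟩ := exists_lintegral_density_le hA h
  refine ⟨fun z hz => hz.1, _, Real.exp_pos (-(Real.log 32 + 14 * (6 * (32 * M) + M))),
    fun a ha => le_tprod_of_le_finset_prod (fun w => ?_) (fun w => ?_) fun S => ?_⟩
  · rw [pseudoDist]; positivity
  · rw [pseudoDist_eq_norm_diskAut]
    exact (mem_disk.1 (diskAut_mem_disk ha.1 w.2.1.1)).le
  · have := exp_neg_le_prod_pseudoDist hA hf hM0 ha (hM a ha.1)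
      (fun z hz => density_le_of_norm_le_half (fun j b hb => norm_coeff_le hA hM0 hM j hb) ha.1 hz)
      (S.map (Function.Embedding.subtype _)) ?_
    · rwa [Finset.prod_map] at this
    · intro w hw
      obtain ⟨v, -, rfl⟩ := Finset.mem_map.1 hw
      exact ⟨v.2.1.1, v.2.2, (derivatives_of_mem_twoFoldZeros hf.1 v.2.1).1⟩

lemma isFiniteUnionOf_of_self {P : Set ℂ → Prop} {Z : Set ℂ} (h : P Z) : IsFiniteUnionOf P Z :=
  ⟨1, fun _ => Z, fun _ => h, (iUnion_const Z).symm⟩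

end DiskODE

theorem theorem1 (A : Fin 3 → ℂ → ℂ) (hA : ∀ j, DifferentiableOn ℂ (A j) DiskODE.disk)
    (f : ℂ → ℂ) (hf : DiskODE.IsSolution A f) (hf0 : ∃ z ∈ DiskODE.disk, f z ≠ 0) :
    ((∀ j : Fin 3, BddAbove
        ((fun z : ℂ => ‖A j z‖ * (1 - ‖z‖ ^ 2) ^ (3 - (j : ℕ))) '' DiskODE.disk)) →
      DiskODE.IsFiniteUnionOf DiskODE.IsSeparated (DiskODE.twoFoldZeros f)) ∧
    ((∀ j : Fin 3,
        (⨆ a ∈ DiskODE.disk, ∫⁻ z, ENNReal.ofReal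
          (‖A j z‖ * (1 - ‖z‖ ^ 2) ^ (1 - ((j : ℕ) : ℤ)) * (1 - ‖DiskODE.diskAut a z‖ ^ 2))
          ∂DiskODE.areaMeasure) < ⊤) →
      DiskODE.IsFiniteUnionOf DiskODE.IsUniformlySeparated (DiskODE.twoFoldZeros f)) :=
  ⟨fun h => DiskODE.isFiniteUnionOf_of_self (DiskODE.isSeparated_twoFoldZeros hf h),
    fun h => DiskODE.isFiniteUnionOf_of_self (DiskODE.isUniformlySeparated_twoFoldZeros hA hf h)⟩
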